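/- For $n\in\mathbb N$ let $T(n,\mathbb R)$ be the Lie group of real lower triangular $n\times n$ matrices with positive diagonal entries, with Lie algebra $\mathfrak t(n,\mathbb R)$ the lower triangular matrices. Let $\langle\cdot,\cdot\rangle_{E}$ be the inner product on $\mathfrak t(n,\mathbb R)$ for which diagonal and strictly lower triangular matrices are orthogonal and which equals $2\,\mathrm{tr}(XY^t)$ on diagonal matrices and $\mathrm{tr}(XY^t)$ on strictly lower triangular matrices; the left-invariant Riemannian metric $g_E$ on $T(n,\mathbb R)$ that it defines, $g_E(U,V)=\langle A^{-1}U,A^{-1}V\rangle_E$ at $A$, is called the Einstein metric of $T(n,\mathbb R)$ (with it, $T(n,\mathbb R)$ is isometric to $GL(n,\mathbb R)/O(n,\mathbb R)$ with its symmetric metric), and it is considered up to a positive scale. **Theorem.** Let $G$ be a simply-connected (finite-dimensional, real) Lie group which is 2-step nilpotent, that is, $[\mathfrak g,[\mathfrak g,\mathfrak g]]=0$ for its Lie algebra $\mathfrak g$, and let $g$ be any left-invariant Riemannian metric on $G$. Then there exist $n\in\mathbb N$, a scale $c>0$ and a group homomorphism $\varphi:G\to T(n,\mathbb R)$ which is an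 isometric embedding of Riemannian manifolds $(G,g)\to(T(n,\mathbb R),c\,g_E)$: $\varphi$ is smooth, a homeomorphism onto its image, and $\varphi^*(c\,g_E)=g$. -/

import Mathlib

open scoped Manifold ContDiff

/-! ### Left-invariant metrics, isometric embeddings, two-step nilpotency -/

section General

open Bundle

/-- A Riemannian metric `g` on a Lie group `G` is left-invariant if every left translation
`x ↦ a * x` is an isometry. -/
def IsLeftInvariantMetric
    {E : Type*} [NormedAddCommGroup E] [NormedSpace ℝ E]
    {G : Type*} [TopologicalSpace G] [ChartedSpace E G] [Group G] [IsManifold 𝓘(ℝ, E) ∞ G]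
    (g : ContMDiffRiemannianMetric 𝓘(ℝ, E) ∞ E (fun x : G => TangentSpace 𝓘(ℝ, E) x)) : Prop :=
  ∀ (a x : G) (v w : TangentSpace 𝓘(ℝ, E) x),
    g.inner (a * x)
        (mfderiv 𝓘(ℝ, E) 𝓘(ℝ, E) (fun y : G => a * y) x v)
        (mfderiv 𝓘(ℝ, E) 𝓘(ℝ, E) (fun y : G => a * y) x w) =
      g.inner x v w

/-- An isometric embedding `f` of Riemannian manifolds `(M, g) → (N, h)`: a smooth map which is a
homeomorphism onto its image and pulls `h` back to `g` (so that it is, in particular, an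
immersion). -/
structure IsIsometricEmbedding
    {E : Type*} [NormedAddCommGroup E] [NormedSpace ℝ E]
    {M : Type*} [TopologicalSpace M] [ChartedSpace E M] [IsManifold 𝓘(ℝ, E) ∞ M]
    {F : Type*} [NormedAddCommGroup F] [NormedSpace ℝ F]
    {N : Type*} [TopologicalSpace N] [ChartedSpace F N] [IsManifold 𝓘(ℝ, F) ∞ N]
    (g : ContMDiffRiemannianMetric 𝓘(ℝ, E) ∞ E (fun x : M => TangentSpace 𝓘(ℝ, E) x))
    (h : ContMDiffRiemannianMetric 𝓘(ℝ, F) ∞ F (fun y : N => TangentSpace 𝓘(ℝ, F) y))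
    (f : M → N) : Prop where
  contMDiff : ContMDiff 𝓘(ℝ, E) 𝓘(ℝ, F) ∞ f
  isEmbedding : Topology.IsEmbedding f
  isometric : ∀ (x : M) (v w : TangentSpace 𝓘(ℝ, E) x),
    h.inner (f x) (mfderiv 𝓘(ℝ, E) 𝓘(ℝ, F) f x v) (mfderiv 𝓘(ℝ, E) 𝓘(ℝ, F) f x w) =
      g.inner x v w

/-- A smooth Lie group is in particular of the class for which its Lie algebra is defined. -/
instance instLieGroupMinSmoothness
    {E : Type*} [NormedAddCommGroup E] [NormedSpace ℝ E]
    {G : Type*} [TopologicalSpace G] [ChartedSpace E G] [Group G] [LieGroup 𝓘(ℝ, E) ∞ G] :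
    LieGroup 𝓘(ℝ, E) (minSmoothness ℝ 3) G := by
  rw [minSmoothness_of_isRCLikeNormedField]
  exact LieGroup.of_le (n := ∞) (by exact ENat.LEInfty.out)

/-- The Lie group `G` is (at most) two-step nilpotent: its Lie algebra `𝔤` satisfies
`[𝔤, [𝔤, 𝔤]] = 0`. -/
def IsTwoStepNilpotentLieGroup
    (E : Type*) [NormedAddCommGroup E] [NormedSpace ℝ E] [FiniteDimensional ℝ E]
    (G : Type*) [TopologicalSpace G] [ChartedSpace E G] [Group G] [LieGroup 𝓘(ℝ, E) ∞ G] : Prop :=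
  LieModule.lowerCentralSeries ℝ (GroupLieAlgebra 𝓘(ℝ, E) G) (GroupLieAlgebra 𝓘(ℝ, E) G) 2 = ⊥

end General

/-! ### The group `T(n, ℝ)` of lower triangular matrices -/

/-- The algebra `𝔱(n, ℝ)` of real lower triangular `n × n` matrices. -/
def lowerTriangular (n : ℕ) : Subalgebra ℝ (Matrix (Fin n) (Fin n) ℝ) where
  carrier := {A | ∀ i j, i < j → A i j = 0}
  mul_mem' {A B} hA hB i j hij := by
    rw [Matrix.mul_apply]
    refine Finset.sum_eq_zero fun k _ => ?_
    rcases lt_or_ge i k with h | h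
    · rw [hA i k h, zero_mul]
    · rw [hB k j (lt_of_le_of_lt h hij), mul_zero]
  add_mem' {A B} hA hB i j hij := by
    rw [Matrix.add_apply, hA i j hij, hB i j hij, add_zero]
  algebraMap_mem' r i j hij := by
    simp [Matrix.algebraMap_matrix_apply, hij.ne]

section Norm

open scoped Matrix.Norms.Frobenius

/-- `𝔱(n, ℝ)` with the Frobenius norm. The norm only serves to do calculus on this
finite-dimensional space, and it induces the usual topology. -/
noncomputable instance instNormedRingLowerTriangular (n : ℕ) : NormedRing (lowerTriangular n) :=
  Subalgebra.normedRing (lowerTriangular n)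

noncomputable instance instNormedAlgebraLowerTriangular (n : ℕ) :
    NormedAlgebra ℝ (lowerTriangular n) :=
  Subalgebra.toNormedAlgebra (lowerTriangular n)

noncomputable instance instTopologicalSpaceLowerTriangular (n : ℕ) :
    TopologicalSpace (lowerTriangular n) :=
  (instNormedRingLowerTriangular n).toMetricSpace.toPseudoMetricSpace.toUniformSpace.toTopologicalSpace

instance (n : ℕ) : FiniteDimensional ℝ (lowerTriangular n) :=
  FiniteDimensional.finiteDimensional_submodule (Subalgebra.toSubmodule (lowerTriangular n))

theorem continuous_lowerTriangular_apply {n : ℕ} (i j : Fin n) :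
    Continuous fun A : lowerTriangular n => A.1 i j :=
  LinearMap.continuous_of_finiteDimensional
    ({ toFun := fun A : lowerTriangular n => A.1 i j
       map_add' := fun _ _ => rfl
       map_smul' := fun _ _ => rfl } : lowerTriangular n →ₗ[ℝ] ℝ)

end Norm

theorem lowerTriangular_mul_diag {n : ℕ} (A B : lowerTriangular n) (i : Fin n) :
    (A * B).1 i i = A.1 i i * B.1 i i := by
  change (A.1 * B.1) i i = _
  rw [Matrix.mul_apply]
  refine Finset.sum_eq_single i (fun k _ hk => ?_) (by simp)
  rcases lt_or_gt_of_ne hk with h | h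
  · rw [B.2 k i h, mul_zero]
  · rw [A.2 i k h, zero_mul]

/-- The lower triangular matrices with positive diagonal entries form an open subset of
`𝔱(n, ℝ)`. -/
def posDiagonal (n : ℕ) : TopologicalSpace.Opens (lowerTriangular n) where
  carrier := {A | ∀ i, 0 < A.1 i i}
  is_open' := by
    simp only [Set.ofPred_forall]
    exact isOpen_iInter_of_finite fun i =>
      isOpen_lt continuous_const (continuous_lowerTriangular_apply i i)

theorem posDiagonal_mul_inv {n : ℕ} {A : lowerTriangular n} (hA : A ∈ posDiagonal n) :
    ∃ B : lowerTriangular n, B ∈ posDiagonal n ∧ A * B = 1 ∧ B * A = 1 := by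
  have hdet : IsUnit A.1.det := by
    have : A.1.IsLowerTriangular := fun i j hij => A.2 i j hij
    rw [Matrix.det_of_isLowerTriangular _ this]
    exact (Finset.prod_pos fun i _ => hA i).ne'.isUnit
  let _ := Matrix.invertibleOfIsUnitDet _ hdet
  have hB : A.1⁻¹.BlockTriangular OrderDual.toDual :=
    Matrix.blockTriangular_inv_of_blockTriangular (fun i j hij => A.2 i j hij)
  let B : lowerTriangular n := ⟨A.1⁻¹, fun i j hij => hB hij⟩
  have h1 : A * B = 1 := Subtype.ext (Matrix.mul_nonsing_inv _ hdet)
  have h2 : B * A = 1 := Subtype.ext (Matrix.nonsing_inv_mul _ hdet)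
  refine ⟨B, fun i => ?_, h1, h2⟩
  have h := lowerTriangular_mul_diag A B i
  rw [h1] at h
  have h' : (1 : ℝ) = A.1 i i * B.1 i i := by
    rw [← h]
    change (1 : ℝ) = (1 : Matrix (Fin n) (Fin n) ℝ) i i
    simp
  have h3 : 0 < A.1 i i * B.1 i i := by rw [← h']; exact one_pos
  exact (pos_iff_pos_of_mul_pos h3).1 (hA i)

theorem posDiagonal_ringInverse {n : ℕ} {A : lowerTriangular n} (hA : A ∈ posDiagonal n) :
    Ring.inverse A ∈ posDiagonal n ∧ A * Ring.inverse A = 1 ∧ Ring.inverse A * A = 1 := by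
  obtain ⟨B, hB, h1, h2⟩ := posDiagonal_mul_inv hA
  have : Ring.inverse A = B := Ring.inverse_unit ⟨A, B, h1, h2⟩
  rw [this]
  exact ⟨hB, h1, h2⟩

/-- `T(n, ℝ)`: the group of real lower triangular `n × n` matrices with positive diagonal entries.
As an open subset of the vector space `𝔱(n, ℝ)` it is a manifold, all of whose tangent spaces are
`𝔱(n, ℝ)`. -/
abbrev TriangularGroup (n : ℕ) : Type := posDiagonal n

noncomputable instance (n : ℕ) : Group (TriangularGroup n) where
  mul A B := ⟨A.1 * B.1, fun i => by
    rw [lowerTriangular_mul_diag]; exact mul_pos (A.2 i) (B.2 i)⟩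
  one := ⟨1, fun i => by
    change (0 : ℝ) < (1 : Matrix (Fin n) (Fin n) ℝ) i i
    simp⟩
  inv A := ⟨Ring.inverse A.1, (posDiagonal_ringInverse A.2).1⟩
  mul_assoc A B C := Subtype.ext (mul_assoc A.1 B.1 C.1)
  one_mul A := Subtype.ext (one_mul A.1)
  mul_one A := Subtype.ext (mul_one A.1)
  inv_mul_cancel A := Subtype.ext (posDiagonal_ringInverse A.2).2.2

theorem TriangularGroup.coe_mul {n : ℕ} (A B : TriangularGroup n) :
    (A * B).1 = A.1 * B.1 := rfl

theorem TriangularGroup.coe_inv {n : ℕ} (A : TriangularGroup n) :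
    (A⁻¹).1 = Ring.inverse A.1 := rfl

theorem contMDiff_triangularGroup_inv (n : ℕ) :
    ContMDiff 𝓘(ℝ, lowerTriangular n) 𝓘(ℝ, lowerTriangular n) ∞
      (fun A : TriangularGroup n => Ring.inverse A.1) := by
  intro A
  have hu : IsUnit A.1 :=
    ⟨⟨A.1, _, (posDiagonal_ringInverse A.2).2.1, (posDiagonal_ringInverse A.2).2.2⟩, rfl⟩
  obtain ⟨u, hu⟩ := hu
  have h : ContDiffAt ℝ ∞ Ring.inverse A.1 := hu ▸ contDiffAt_ringInverse ℝ u
  exact h.contMDiffAt.comp A (contMDiff_subtype_val A)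

instance (n : ℕ) : LieGroup 𝓘(ℝ, lowerTriangular n) ∞ (TriangularGroup n) where
  contMDiff_mul := by
    rw [← ContMDiff.subtypeVal_comp_iff]
    have h : ContMDiff (𝓘(ℝ, lowerTriangular n).prod 𝓘(ℝ, lowerTriangular n))
        𝓘(ℝ, lowerTriangular n × lowerTriangular n) ∞
        (fun p : TriangularGroup n × TriangularGroup n => (p.1.1, p.2.1)) :=
      (contMDiff_subtype_val.comp contMDiff_fst).prodMk_space
        (contMDiff_subtype_val.comp contMDiff_snd)
    exact (contDiff_fst.mul contDiff_snd).contMDiff.comp h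
  contMDiff_inv := by
    rw [← ContMDiff.subtypeVal_comp_iff]
    exact contMDiff_triangularGroup_inv n

/-! ### The Einstein metric on `T(n, ℝ)` -/

/-- The inner product on `𝔱(n, ℝ)` which makes the diagonal and the strictly lower triangular
matrices orthogonal, and which is `2 tr(X Yᵗ)` on the former and `tr(X Yᵗ)` on the latter. -/
noncomputable def einsteinForm (n : ℕ) :
    lowerTriangular n →ₗ[ℝ] lowerTriangular n →ₗ[ℝ] ℝ :=
  LinearMap.mk₂ ℝ
    (fun X Y => 2 * ∑ i, X.1 i i * Y.1 i i + ∑ i, ∑ j with j < i, X.1 i j * Y.1 i j)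
    (fun X X' Y => by
      simp only [Subalgebra.coe_add, Matrix.add_apply, add_mul, Finset.sum_add_distrib]; ring)
    (fun a X Y => by
      simp only [Subalgebra.coe_smul, Matrix.smul_apply, smul_eq_mul, mul_assoc,
        ← Finset.mul_sum]; ring)
    (fun X Y Y' => by
      simp only [Subalgebra.coe_add, Matrix.add_apply, mul_add, Finset.sum_add_distrib]; ring)
    (fun a X Y => by
      simp only [Subalgebra.coe_smul, Matrix.smul_apply, smul_eq_mul, mul_left_comm _ a,
        ← Finset.mul_sum]; ring)

theorem einsteinForm_apply {n : ℕ} (X Y : lowerTriangular n) :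
    einsteinForm n X Y =
      2 * ∑ i, X.1 i i * Y.1 i i + ∑ i, ∑ j with j < i, X.1 i j * Y.1 i j := rfl

theorem einsteinForm_symm {n : ℕ} (X Y : lowerTriangular n) :
    einsteinForm n X Y = einsteinForm n Y X := by
  simp only [einsteinForm_apply, mul_comm]

theorem sq_le_einsteinForm {n : ℕ} (X : lowerTriangular n) (i j : Fin n) :
    (X.1 i j) ^ 2 ≤ einsteinForm n X X := by
  rw [einsteinForm_apply]
  have h1 : 0 ≤ ∑ i, X.1 i i * X.1 i i := Finset.sum_nonneg fun i _ => mul_self_nonneg _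
  have h2 : ∀ i, 0 ≤ ∑ j with j < i, X.1 i j * X.1 i j :=
    fun i => Finset.sum_nonneg fun j _ => mul_self_nonneg _
  have h3 : 0 ≤ ∑ i, ∑ j with j < i, X.1 i j * X.1 i j := Finset.sum_nonneg fun i _ => h2 i
  rcases lt_trichotomy i j with h | h | h
  · rw [X.2 i j h]; nlinarith
  · subst h
    have := Finset.single_le_sum (f := fun i => X.1 i i * X.1 i i)
      (fun i _ => mul_self_nonneg _) (Finset.mem_univ i)
    beta_reduce at this
    nlinarith
  · have h4 := Finset.single_le_sum (f := fun i => ∑ j with j < i, X.1 i j * X.1 i j)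
      (fun i _ => h2 i) (Finset.mem_univ i)
    have h5 := Finset.single_le_sum (s := Finset.univ.filter (· < i))
      (f := fun j => X.1 i j * X.1 i j)
      (fun j _ => mul_self_nonneg _) (by simpa using h : j ∈ Finset.univ.filter (· < i))
    beta_reduce at h4 h5
    nlinarith

theorem einsteinForm_pos {n : ℕ} {X : lowerTriangular n} (hX : X ≠ 0) :
    0 < einsteinForm n X X := by
  by_contra h
  apply hX
  apply Subtype.ext
  ext i j
  have := sq_le_einsteinForm X i j
  have : (X.1 i j) ^ 2 = 0 := le_antisymm (by linarith) (sq_nonneg _)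
  simpa using this

/-- The continuous bilinear form `(U, V) ↦ c ⟨P U, P V⟩` on `𝔱(n, ℝ)`, where `⟨ , ⟩` is
`einsteinForm n`. -/
noncomputable def translatedForm (n : ℕ) (c : ℝ) (P : lowerTriangular n) :
    lowerTriangular n →L[ℝ] lowerTriangular n →L[ℝ] ℝ :=
  c • (LinearMap.toContinuousBilinearMap (einsteinForm n)).bilinearComp
    (ContinuousLinearMap.mul ℝ (lowerTriangular n) P)
    (ContinuousLinearMap.mul ℝ (lowerTriangular n) P)

theorem translatedForm_apply {n : ℕ} (c : ℝ) (P U V : lowerTriangular n) :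
    translatedForm n c P U V = c * einsteinForm n (P * U) (P * V) := rfl

theorem contDiff_translatedForm (n : ℕ) (c : ℝ) : ContDiff ℝ ∞ (translatedForm n c) := by
  refine contDiff_clm_apply_iff.2 fun U => contDiff_clm_apply_iff.2 fun V => ?_
  have hB : ContDiff ℝ ∞ fun p : lowerTriangular n × lowerTriangular n =>
      LinearMap.toContinuousBilinearMap (einsteinForm n) p.1 p.2 :=
    (ContinuousLinearMap.isBoundedBilinearMap _).contDiff
  have h : ContDiff ℝ ∞ fun P : lowerTriangular n => (P * U, P * V) :=
    (contDiff_id.mul contDiff_const).prodMk (contDiff_id.mul contDiff_const)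
  exact contDiff_const.mul (hB.comp h)

theorem translatedForm_symm {n : ℕ} (c : ℝ) (P U V : lowerTriangular n) :
    translatedForm n c P U V = translatedForm n c P V U := by
  rw [translatedForm_apply, translatedForm_apply, einsteinForm_symm]

theorem translatedForm_pos {n : ℕ} {c : ℝ} (hc : 0 < c) {P : lowerTriangular n}
    (hP : IsUnit P) {U : lowerTriangular n} (hU : U ≠ 0) : 0 < translatedForm n c P U U := by
  rw [translatedForm_apply]
  exact mul_pos hc (einsteinForm_pos (by rwa [Ne, hP.mul_right_eq_zero]))

theorem isVonNBounded_translatedForm {n : ℕ} {c : ℝ} (hc : 0 < c) {P : lowerTriangular n}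
    (hP : IsUnit P) :
    Bornology.IsVonNBounded ℝ {U : lowerTriangular n | translatedForm n c P U U < 1} := by
  let f : lowerTriangular n →ₗ[ℝ] (Fin n → Fin n → ℝ) :=
    { toFun := fun U i j => (P * U).1 i j
      map_add' := fun U V => by rw [mul_add]; rfl
      map_smul' := fun a U => by rw [mul_smul_comm]; rfl }
  have hf : LinearMap.ker f = ⊥ := by
    refine LinearMap.ker_eq_bot'.2 fun U hU => ?_
    refine hP.mul_right_eq_zero.1 (Subtype.ext ?_)
    ext i j
    exact congrFun (congrFun hU i) j
  obtain ⟨K, -, hK⟩ := f.exists_antilipschitzWith hf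
  rw [NormedSpace.isVonNBounded_iff, isBounded_iff_forall_norm_le]
  refine ⟨K * (1 + 1 / c), fun U hU => ?_⟩
  have h1 : ‖U‖ ≤ K * ‖f U‖ := by
    have := hK.le_mul_dist U 0
    simpa [dist_zero_right] using this
  refine h1.trans (mul_le_mul_of_nonneg_left ?_ K.2)
  have hc' : 0 < 1 / c := by positivity
  refine (pi_norm_le_iff_of_nonneg (by positivity)).2 fun i =>
    (pi_norm_le_iff_of_nonneg (by positivity)).2 fun j => ?_
  change |(P * U).1 i j| ≤ _
  have hU' : c * einsteinForm n (P * U) (P * U) < 1 := hU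
  have h2 := sq_le_einsteinForm (P * U) i j
  have h3 : einsteinForm n (P * U) (P * U) < 1 / c := by
    rw [lt_div_iff₀ hc, mul_comm]; exact hU'
  refine abs_le_of_sq_le_sq ?_ (by positivity)
  nlinarith

theorem isUnit_inv_triangularGroup {n : ℕ} (A : TriangularGroup n) :
    IsUnit (A⁻¹ : TriangularGroup n).1 :=
  ⟨⟨_, A.1, (posDiagonal_ringInverse A.2).2.2, (posDiagonal_ringInverse A.2).2.1⟩, rfl⟩

open Bundle in
/-- A smooth family of bilinear forms on `𝔱(n, ℝ)` is a smooth section of the bundle of bilinear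
forms on the tangent spaces of `T(n, ℝ)`. -/
theorem contMDiff_section_triangularGroup {n : ℕ}
    (b : TriangularGroup n → lowerTriangular n →L[ℝ] lowerTriangular n →L[ℝ] ℝ)
    (hb : ContMDiff 𝓘(ℝ, lowerTriangular n)
      𝓘(ℝ, lowerTriangular n →L[ℝ] lowerTriangular n →L[ℝ] ℝ) ∞ b) :
    ContMDiff 𝓘(ℝ, lowerTriangular n)
      (𝓘(ℝ, lowerTriangular n).prod 𝓘(ℝ, lowerTriangular n →L[ℝ] lowerTriangular n →L[ℝ] ℝ)) ∞
      (fun A : TriangularGroup n =>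
        TotalSpace.mk' (lowerTriangular n →L[ℝ] lowerTriangular n →L[ℝ] ℝ)
          (E := fun A : TriangularGroup n => TangentSpace 𝓘(ℝ, lowerTriangular n) A →L[ℝ]
            TangentSpace 𝓘(ℝ, lowerTriangular n) A →L[ℝ] ℝ) A (b A)) := by
  intro A
  rw [contMDiffAt_hom_bundle]
  refine ⟨contMDiffAt_id, ?_⟩
  have h : (fun B : TriangularGroup n => ContinuousLinearMap.inCoordinates
      (lowerTriangular n) (fun B : TriangularGroup n => TangentSpace 𝓘(ℝ, lowerTriangular n) B)
      (lowerTriangular n →L[ℝ] ℝ)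
      (fun B : TriangularGroup n => TangentSpace 𝓘(ℝ, lowerTriangular n) B →L[ℝ] ℝ)
      A B A B (b B)) = b := by
    funext B
    have hB : B ∈ (chartAt (lowerTriangular n) A).source := mem_chart_source (lowerTriangular n) B
    have hc (U : lowerTriangular n) :
        (trivializationAt (lowerTriangular n) (TangentSpace 𝓘(ℝ, lowerTriangular n)) A).symm B U
          = U := by
      have h1 := TangentBundle.symmL_trivializationAt_eq_core
        (I := 𝓘(ℝ, lowerTriangular n)) (b₀ := A) hB
      have h2 := congrArg (fun L => L U) h1
      refine Eq.trans ?_ (h2.trans ?_)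
      · exact (Bundle.Trivialization.symmL_apply (hb := hB) ..).symm
      · exact (tangentBundleCore 𝓘(ℝ, lowerTriangular n) (TriangularGroup n)).coordChange_self
          (achart (lowerTriangular n) B) B hB U
    ext1 U
    ext1 V
    have := inCoordinates_apply_eq₂ (𝕜 := ℝ) (F₁ := lowerTriangular n) (F₂ := lowerTriangular n)
      (F₃ := ℝ) (E₁ := fun B : TriangularGroup n => TangentSpace 𝓘(ℝ, lowerTriangular n) B)
      (E₂ := fun B : TriangularGroup n => TangentSpace 𝓘(ℝ, lowerTriangular n) B)
      (E₃ := fun _ => ℝ) (x₀ := A) (x := B) (ϕ := b B) (v := U) (w := V) hB hB (Set.mem_univ _)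
    rw [hc, hc] at this
    refine this.trans ?_
    simp
    rfl
  change ContMDiffAt _ _ _ (fun B : TriangularGroup n => ContinuousLinearMap.inCoordinates
      (lowerTriangular n) (fun B : TriangularGroup n => TangentSpace 𝓘(ℝ, lowerTriangular n) B)
      (lowerTriangular n →L[ℝ] ℝ)
      (fun B : TriangularGroup n => TangentSpace 𝓘(ℝ, lowerTriangular n) B →L[ℝ] ℝ)
      A B A B (b B)) A
  rw [h]
  exact hb A

open Bundle in
/-- The left-invariant metric on `T(n, ℝ)` whose value at the identity is `c` times the Einstein
inner product: at `A` it is `(U, V) ↦ c ⟨A⁻¹ U, A⁻¹ V⟩`. -/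
noncomputable def einsteinMetric (n : ℕ) (c : ℝ) (hc : 0 < c) :
    ContMDiffRiemannianMetric 𝓘(ℝ, lowerTriangular n) ∞ (lowerTriangular n)
      (fun A : TriangularGroup n => TangentSpace 𝓘(ℝ, lowerTriangular n) A) where
  inner A := translatedForm n c (A⁻¹).1
  symm _ U V := translatedForm_symm c _ U V
  pos A _ hU := translatedForm_pos hc (isUnit_inv_triangularGroup A) hU
  isVonNBounded A := isVonNBounded_translatedForm hc (isUnit_inv_triangularGroup A)
  contMDiff := contMDiff_section_triangularGroup _
    ((contDiff_translatedForm n c).contMDiff.comp (contMDiff_triangularGroup_inv n))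

/-! The group is first linearised. On a two-step nilpotent Lie algebra the Baker-Campbell-Hausdorff
product is X + Y + ½[X, Y], and `exists_global_logarithm` gives a smooth homomorphism Ψ from G to
the algebra with this product. Its derivative in the left-invariant trivialization is v + ½[Ψ, v].
No exponential map is used: this differential equation is solved near 1 by two applications of the
Poincaré lemma (`exists_logarithm`), the solution is a local homomorphism by uniqueness, and it
globalises because G is simply connected (`exists_monoidHom_eventuallyEq`). The inverse function
theorem and a path argument make Ψ an embedding (`isEmbedding_of_isLogarithmicAt`).

The rest is algebra. Suppose r is linear into strictly lower triangular matrices with r X · r Y = ½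
r [X, Y]. Then X ↦ 1 + r X turns the BCH product into the matrix product, so φ = 1 + r ∘ Ψ is a
homomorphism. The same identity gives dφ(v) = r v + ½ r [Ψ, v] = φ · r v for left-invariant v, so φ
is isometric as soon as c⟨r v, r w⟩ is the given inner product on the Lie algebra.

Such an r is built in `exists_representation_of_orthonormalBasis` from 3 × 3 block matrices whose
only possibly nonzero products lie in the lower left corner. The blocks carry the component
orthogonal to the derived algebra, the component in it, and ad X. The entries of ad X distort the
metric. After rescaling, the distortion is small enough to be compensated by extra coordinates in
the first column, which meet only zero columns and so do not affect products. -/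

open scoped Topology

/-! ### Extending local homomorphisms from simply connected groups -/

section LocalHom

variable {G N : Type*} [TopologicalSpace G] [Group G] [IsTopologicalGroup G] [Group N]

theorem eventually_mul_left_nhds {p : G → Prop} {a : G} (h : ∀ᶠ x in 𝓝 a, p x) :
    ∀ᶠ w in 𝓝 1, p (a * w) := by
  have : Filter.Tendsto (fun w => a * w) (𝓝 1) (𝓝 a) := by
    simpa using (continuous_const_mul a).tendsto (1 : G)
  exact this.eventually h

theorem eventually_inv_mul_nhds {p : G → Prop} (a : G) (h : ∀ᶠ w in 𝓝 1, p w) :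
    ∀ᶠ x in 𝓝 a, p (a⁻¹ * x) := by
  have : Filter.Tendsto (fun x => a⁻¹ * x) (𝓝 a) (𝓝 1) := by
    simpa using (continuous_const_mul a⁻¹).tendsto a
  exact this.eventually h

/-- The bundle with discrete fibre `N` over `G` whose flat sections are locally of the form
`x ↦ n * ψ (a⁻¹ * x)`, for a local homomorphism `ψ`. -/
def localHomBundle (U : Set G) (hU : IsOpen U) (h1 : 1 ∈ U) (ψ : G → N)
    (hψ : ∀ u ∈ U, ∀ᶠ w in 𝓝 1, ψ (u * w) = ψ u * ψ w) [TopologicalSpace N] [DiscreteTopology N] :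
    FiberBundleCore G G N where
  baseSet a := (fun x => a⁻¹ * x) ⁻¹' U
  isOpen_baseSet a := hU.preimage (continuous_const_mul _)
  indexAt x := x
  mem_baseSet_at x := by simpa using h1
  -- A formal coboundary, so the cocycle identities are automatic. The local homomorphism property
  -- is needed only for local constancy: near x both values of ψ acquire the same right factor ψ
  -- (x⁻¹ * y), which cancels.
  coordChange a b x n := n * ψ (a⁻¹ * x) * (ψ (b⁻¹ * x))⁻¹
  coordChange_self a x _ n := by group
  continuousOn_coordChange a b := by
    rintro ⟨x, n⟩ ⟨⟨ha, hb⟩, -⟩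
    refine ContinuousAt.continuousWithinAt ?_
    have h : ∀ c : G, c⁻¹ * x ∈ U → ∀ᶠ y in 𝓝 x, ψ (c⁻¹ * y) = ψ (c⁻¹ * x) * ψ (x⁻¹ * y) := by
      intro c hc
      filter_upwards [eventually_inv_mul_nhds x (hψ _ hc)] with y hy
      rw [← hy]; congr 1; group
    have h2 : (fun p : G × N => p.2 * ψ (a⁻¹ * p.1) * (ψ (b⁻¹ * p.1))⁻¹) =ᶠ[𝓝 (x, n)]
        fun _ => n * ψ (a⁻¹ * x) * (ψ (b⁻¹ * x))⁻¹ := by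
      rw [nhds_prod_eq, nhds_discrete N]
      have h3 : ∀ᶠ p : G × N in 𝓝 x ×ˢ pure n, p.2 = n :=
        Filter.Eventually.prod_inr (p := (· = n)) (Filter.eventually_pure.2 rfl) _
      filter_upwards [h3, (h a ha).prod_inl _, (h b hb).prod_inl _] with p hp hpa hpb
      rw [hp, hpa, hpb]
      group
    exact continuousAt_const.congr h2.symm
  coordChange_comp a b c x _ n := by group

/-- A local homomorphism on a simply connected group extends to a homomorphism. -/
theorem exists_monoidHom_eventuallyEq [SimplyConnectedSpace G] [LocallyPathConnectedSpace G]
    {U : Set G} (hU : IsOpen U) (h1 : 1 ∈ U) (ψ : G → N)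
    (hψ : ∀ u ∈ U, ∀ᶠ w in 𝓝 1, ψ (u * w) = ψ u * ψ w) :
    ∃ Ψ : G →* N, Ψ =ᶠ[𝓝 1] ψ := by
  have hψ1 : ψ 1 = 1 := by simpa using (hψ 1 h1).self_of_nhds
  let _ : TopologicalSpace N := ⊥
  have : DiscreteTopology N := ⟨rfl⟩
  let Z := localHomBundle U hU h1 ψ hψ
  have hcov : IsCoveringMap Z.proj := FiberBundle.isCoveringMap (F := N) (E := Z.Fiber)
  -- Simple connectedness enters here: the identity of G lifts to a global flat section through (1,
  -- 1).
  obtain ⟨F, ⟨hF1, hF⟩, -⟩ := hcov.existsUnique_continuousMap_lifts (ContinuousMap.id G) 1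
    (⟨1, (1 : N)⟩ : Z.TotalSpace) rfl
  have hp (x : G) : (F x).1 = x := congrFun hF x
  let Ψ : G → N := fun x => (F x).2
  -- In the trivialization indexed by a, the section is Ψ x * (ψ (a⁻¹ * x))⁻¹, which is locally
  -- constant since the fibre is discrete.
  have hloc (a : G) : ∀ᶠ w in 𝓝 1, Ψ (a * w) = Ψ a * ψ w := by
    have hsrc : F a ∈ (Z.localTriv a).source := by
      rw [Z.mem_localTriv_source]
      change a⁻¹ * (F a).1 ∈ U
      rw [hp]; simpa using h1
    have hc : ContinuousAt (fun x => (Z.localTriv a (F x)).2) a :=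
      continuous_snd.continuousAt.comp
        (((Z.localTriv a).continuousOn.continuousAt
          ((Z.localTriv a).open_source.mem_nhds hsrc)).comp F.continuous.continuousAt)
    have he := hc.eventually (p := fun n => n = (Z.localTriv a (F a)).2) (by
      rw [nhds_discrete]; exact rfl)
    filter_upwards [eventually_mul_left_nhds he] with w hw
    change Ψ (a * w) * ψ ((F (a * w)).1⁻¹ * (F (a * w)).1) * (ψ (a⁻¹ * (F (a * w)).1))⁻¹ =
      Ψ a * ψ ((F a).1⁻¹ * (F a).1) * (ψ (a⁻¹ * (F a).1))⁻¹ at hw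
    simp only [hp, inv_mul_cancel, hψ1, mul_one, inv_one, inv_mul_cancel_left] at hw
    rw [← hw]; group
  have hΨ1 : Ψ 1 = 1 := by
    change (show N from (F 1).2) = 1
    rw [hF1]
  have hmul (x y : G) : Ψ (x * y) = Ψ x * Ψ y := by
    -- Moving y to y * w multiplies both sides by ψ w on the right, so the truth of the equation is
    -- locally constant in y; G is connected.
    have hcl : IsClopen {y : G | Ψ (x * y) = Ψ x * Ψ y} := by
      have key (y : G) : ∀ᶠ w in 𝓝 1,
          (Ψ (x * (y * w)) = Ψ x * Ψ (y * w) ↔ Ψ (x * y) = Ψ x * Ψ y) := by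
        filter_upwards [hloc (x * y), hloc y] with w h1 h2
        rw [← mul_assoc, h1, h2, ← mul_assoc, mul_left_inj]
      have key' (y : G) : ∀ᶠ z in 𝓝 y,
          (Ψ (x * z) = Ψ x * Ψ z ↔ Ψ (x * y) = Ψ x * Ψ y) := by
        filter_upwards [eventually_inv_mul_nhds y (key y)] with z hz
        simpa using hz
      constructor
      · rw [← isOpen_compl_iff, isOpen_iff_mem_nhds]
        intro y hy
        filter_upwards [key' y] with z hz h
        exact hy (hz.1 h)
      · rw [isOpen_iff_mem_nhds]
        intro y hy
        filter_upwards [key' y] with z hz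
        exact hz.2 hy
    have := hcl.eq_univ ⟨1, by simp [hΨ1]⟩
    exact (Set.eq_univ_iff_forall.1 this) y
  refine ⟨⟨⟨Ψ, hΨ1⟩, hmul⟩, ?_⟩
  filter_upwards [hloc 1] with w hw
  simpa [hΨ1] using hw

end LocalHom

/-! ### The logarithmic differential equation on a vector space -/

section MaurerCartan

variable {E : Type*} [NormedAddCommGroup E] [NormedSpace ℝ E] {β : E →L[ℝ] E →L[ℝ] E}

theorem eqOn_of_hasFDerivAt {F : Type*} [NormedAddCommGroup F] [NormedSpace ℝ F]
    {s : Set E} (hs : IsPreconnected s) (hso : IsOpen s) {f g : E → F} {f' : E → E →L[ℝ] F}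
    (hf : ∀ y ∈ s, HasFDerivAt f (f' y) y) (hg : ∀ y ∈ s, HasFDerivAt g (f' y) y)
    {y₀ : E} (hy₀ : y₀ ∈ s) (h : f y₀ = g y₀) : Set.EqOn f g s := by
  intro y hy
  have hd : ∀ z ∈ s, HasFDerivAt (fun z => f z - g z) (0 : E →L[ℝ] F) z := fun z hz => by
    simpa using (hf z hz).fun_sub (hg z hz)
  have := hso.is_const_of_fderiv_eq_zero hs
    (fun z hz => (hd z hz).differentiableAt.differentiableWithinAt) (fun z hz => (hd z hz).fderiv)
    hy hy₀
  rw [h, sub_self] at this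
  exact sub_eq_zero.1 this

theorem bracket_swap (halt : ∀ x, β x x = 0) (x y : E) : β x y = -β y x := by
  have := halt (x + y)
  simp only [map_add, add_apply, halt, zero_add, add_zero] at this
  exact eq_neg_of_add_eq_zero_right this

theorem bracket_bracket_right (halt : ∀ x, β x x = 0) (hnil : ∀ x y z, β (β x y) z = 0)
    (x y z : E) : β x (β y z) = 0 := by
  rw [bracket_swap halt, hnil, neg_zero]

/-- Solutions of `df = θ + ½ [f, θ]` with the same initial value agree. -/
theorem eqOn_of_logarithmic_equation (hnil : ∀ x y z, β (β x y) z = 0)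
    {s : Set E} (hs : IsPreconnected s) (hso : IsOpen s) {θ : E → E →L[ℝ] E} {f g : E → E}
    (hf : ∀ y ∈ s, HasFDerivAt f (θ y + (1 / 2 : ℝ) • (β (f y) ∘L θ y)) y)
    (hg : ∀ y ∈ s, HasFDerivAt g (θ y + (1 / 2 : ℝ) • (β (g y) ∘L θ y)) y)
    {y₀ : E} (hy₀ : y₀ ∈ s) (h : f y₀ = g y₀) : Set.EqOn f g s := by
  -- Since β annihilates brackets, the derivative of β ∘ f no longer involves f. Hence β ∘ f is
  -- determined by its initial value, and then so is the right-hand side of the equation for f.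
  have key {f : E → E} (hf : ∀ y ∈ s, HasFDerivAt f (θ y + (1 / 2 : ℝ) • (β (f y) ∘L θ y)) y) :
      ∀ y ∈ s, HasFDerivAt (fun y => β (f y)) (β ∘L θ y) y := by
    intro y hy
    convert! β.hasFDerivAt.comp y (hf y hy) using 1
    ext a b
    simp [hnil]
  have h1 : Set.EqOn (fun y => β (f y)) (fun y => β (g y)) s :=
    eqOn_of_hasFDerivAt hs hso (key hf) (key hg) hy₀ (by simp only [h])
  refine eqOn_of_hasFDerivAt hs hso hf (fun y hy => ?_) hy₀ h
  have h2 : β (f y) = β (g y) := h1 hy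
  rw [h2]
  exact hg y hy

theorem contDiffOn_infty_of_hasFDerivAt {F : Type*} [NormedAddCommGroup F] [NormedSpace ℝ F]
    {s : Set E} (hso : IsOpen s) {f : E → F} {f' : E → E →L[ℝ] F}
    (hf : ∀ y ∈ s, HasFDerivAt f (f' y) y) (hf' : ContDiffOn ℝ ∞ f' s) : ContDiffOn ℝ ∞ f s := by
  rw [contDiffOn_infty_iff_fderiv_of_isOpen hso]
  exact ⟨fun y hy => (hf y hy).differentiableAt.differentiableWithinAt,
    hf'.congr fun y hy => (hf y hy).fderiv⟩

theorem exists_primitive {F : Type*} [NormedAddCommGroup F] [NormedSpace ℝ F] [CompleteSpace F]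
    {s : Set E} (hs : Convex ℝ s) (hso : IsOpen s) {y₀ : E} {η : E → E →L[ℝ] F}
    {η' : E → E →L[ℝ] E →L[ℝ] F} (hη : ContDiffOn ℝ ∞ η s)
    (hη' : ∀ y ∈ s, HasFDerivAt η (η' y) y) (hsymm : ∀ y ∈ s, ∀ a b, η' y a b = η' y b a) :
    ∃ f : E → F, f y₀ = 0 ∧ (∀ y ∈ s, HasFDerivAt f (η y) y) ∧ ContDiffOn ℝ ∞ f s := by
  obtain ⟨f, hf⟩ := hs.exists_forall_hasFDerivAt_of_fderiv_symmetric hso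
    (fun y hy => (hη' y hy).differentiableAt.differentiableWithinAt)
    (fun y hy a b => by rw [(hη' y hy).fderiv, hsymm y hy])
  have hf0 : ∀ y ∈ s, HasFDerivAt (fun y => f y - f y₀) (η y) y :=
    fun y hy => (hf y hy).sub_const _
  exact ⟨fun y => f y - f y₀, sub_self _, hf0, contDiffOn_infty_of_hasFDerivAt hso hf0 hη⟩

/-- If `θ` satisfies the Maurer-Cartan equation `dθ = -½ [θ, θ]` of a two-step nilpotent Lie
algebra, then `df = θ + ½ [f, θ]` has a solution. -/
theorem exists_logarithm [CompleteSpace E] (halt : ∀ x, β x x = 0) (hnil : ∀ x y z, β (β x y) z = 0)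
    {s : Set E} (hs : Convex ℝ s) (hso : IsOpen s) {y₀ : E} (hy₀ : y₀ ∈ s)
    {θ : E → E →L[ℝ] E} {θ' : E → E →L[ℝ] E →L[ℝ] E} (hθ : ContDiffOn ℝ ∞ θ s)
    (hθ' : ∀ y ∈ s, HasFDerivAt θ (θ' y) y)
    (hmc : ∀ y ∈ s, ∀ a b, θ' y a b - θ' y b a = -β (θ y a) (θ y b)) :
    ∃ f : E → E, f y₀ = 0 ∧ (∀ y ∈ s, HasFDerivAt f (θ y + (1 / 2 : ℝ) • (β (f y) ∘L θ y)) y) ∧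
      ContDiffOn ℝ ∞ f s := by
  have hmc' : ∀ y ∈ s, ∀ a b, θ' y a b = θ' y b a - β (θ y a) (θ y b) := fun y hy a b => by
    rw [sub_eq_add_neg, ← hmc y hy a b]; abel
  -- A is the future ad f. The form β ∘ θ is closed because its exterior derivative is β applied to
  -- a bracket.
  obtain ⟨A, hA0, hA, hAs⟩ := exists_primitive (y₀ := y₀) (η := fun y => β ∘L θ y)
    (η' := fun y => (ContinuousLinearMap.compL ℝ E E (E →L[ℝ] E) β) ∘L θ' y)
    hs hso (contDiffOn_const.clm_comp hθ)
    (fun y hy => HasFDerivAt.comp y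
      (g := fun T : E →L[ℝ] E => ContinuousLinearMap.compL ℝ E E (E →L[ℝ] E) β T)
      (ContinuousLinearMap.compL ℝ E E (E →L[ℝ] E) β).hasFDerivAt (hθ' y hy))
    (fun y hy a b => by
      ext c
      simp [hmc' y hy a b, hnil])
  have hA1 (v w : E) : ∀ y ∈ s, A y (β v w) = 0 := by
    refine eqOn_of_hasFDerivAt (f' := fun _ => 0) hs.isPreconnected hso (fun y hy => ?_)
      (fun y _ => hasFDerivAt_const 0 y) hy₀ (by simp [hA0])
    convert! (hA y hy).clm_apply (hasFDerivAt_const (β v w) y) using 1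
    ext a
    simp [bracket_bracket_right halt hnil]
  have hA2 (v : E) : ∀ y ∈ s, β (A y v) = 0 := by
    refine eqOn_of_hasFDerivAt (f' := fun _ => 0) hs.isPreconnected hso (fun y hy => ?_)
      (fun y _ => hasFDerivAt_const 0 y) hy₀ (by simp [hA0])
    convert! β.hasFDerivAt.comp y ((hA y hy).clm_apply (hasFDerivAt_const v y)) using 1
    ext a
    simp [hnil]
  -- With A in place of ad f the right-hand side is a known form. It is closed: the two ½ terms from
  -- dA add up to [θ a, θ b], cancelling dθ, while A applied to dθ vanishes by `hA1`.
  obtain ⟨f, hf0, hf, hfs⟩ := exists_primitive (y₀ := y₀)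
    (η := fun y => θ y + (1 / 2 : ℝ) • (A y ∘L θ y)) hs hso
    (hθ.add ((hAs.clm_comp hθ).const_smul _))
    (fun y hy => (hθ' y hy).add (((hA y hy).clm_comp (hθ' y hy)).const_smul (1 / 2 : ℝ)))
    (fun y hy a b => by
      have h1 := hmc' y hy a b
      have h2 := bracket_swap halt (θ y b) (θ y a)
      have h3 := hA1 (θ y a) (θ y b) y hy
      simp only [one_div, add_apply, FunLike.coe_smul, Pi.smul_apply,
        ContinuousLinearMap.comp_apply, ContinuousLinearMap.compL_apply,
        ContinuousLinearMap.flip_apply, h1, h2, map_sub, h3, sub_zero]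
      module)
  -- Closing the loop: ad f and A have the same derivative, since β annihilates the values of A by
  -- `hA2`.
  have hAf : Set.EqOn (fun y => β (f y)) A s := by
    refine eqOn_of_hasFDerivAt hs.isPreconnected hso (fun y hy => ?_) hA hy₀ (by simp [hA0, hf0])
    convert! β.hasFDerivAt.comp y (hf y hy) using 1
    ext a b
    simp [hA2 _ y hy]
  refine ⟨f, hf0, fun y hy => ?_, hfs⟩
  have h : β (f y) = A y := hAf hy
  rw [h]
  exact hf y hy

end MaurerCartan

/-! ### Left-invariant vector fields and the bracket -/

section LeftInvariantFields

open Bundle VectorField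

variable {E : Type*} [NormedAddCommGroup E] [NormedSpace ℝ E]
  {G : Type*} [TopologicalSpace G] [ChartedSpace E G] [Group G] [LieGroup 𝓘(ℝ, E) ∞ G]

/-- The value at x is the tangent map of multiplication at (x, 1) applied to (0, v), so the field is
a composite of smooth maps. -/
theorem contMDiff_infty_mulInvariantVectorField (v : GroupLieAlgebra 𝓘(ℝ, E) G) :
    ContMDiff 𝓘(ℝ, E) 𝓘(ℝ, E).tangent ∞
      (fun x : G => (TotalSpace.mk' E x (mulInvariantVectorField v x) : TangentBundle 𝓘(ℝ, E) G)) := by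
  let fg : G → TangentBundle 𝓘(ℝ, E) G := fun g => TotalSpace.mk' E g 0
  have sfg : ContMDiff 𝓘(ℝ, E) 𝓘(ℝ, E).tangent ∞ fg := contMDiff_zeroSection _ _
  let fv : G → TangentBundle 𝓘(ℝ, E) G := fun _ => TotalSpace.mk' E 1 v
  have sfv : ContMDiff 𝓘(ℝ, E) 𝓘(ℝ, E).tangent ∞ fv := contMDiff_const
  let F₂ : (TangentBundle 𝓘(ℝ, E) G × TangentBundle 𝓘(ℝ, E) G) →
      TangentBundle (𝓘(ℝ, E).prod 𝓘(ℝ, E)) (G × G) :=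
    (equivTangentBundleProd 𝓘(ℝ, E) G 𝓘(ℝ, E) G).symm
  have S₂ : ContMDiff (𝓘(ℝ, E).tangent.prod 𝓘(ℝ, E).tangent) (𝓘(ℝ, E).prod 𝓘(ℝ, E)).tangent ∞ F₂ :=
    contMDiff_equivTangentBundleProd_symm
  have hm := contMDiff_mul 𝓘(ℝ, E) ∞ (G := G)
  have S₃ := hm.contMDiff_tangentMap (m := ∞) (by norm_num)
  have S := (S₃.comp S₂).comp (sfg.prodMk sfv)
  refine S.congr fun x => ?_
  have h := mfderiv_prod_eq_add_apply (I := 𝓘(ℝ, E)) (I' := 𝓘(ℝ, E)) (I'' := 𝓘(ℝ, E))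
    (f := fun p : G × G => p.1 * p.2) (p := (x, 1))
    (hm.mdifferentiableAt (by simp)) (v := ((0 : TangentSpace 𝓘(ℝ, E) x), v))
  -- The tangent map lands over x * 1, which equals x only propositionally; both fibres are E, so
  -- the vectors can be compared there.
  have key (y : G) (u : E) (hy : y = x) (hu : mulInvariantVectorField v x = u) :
      (TotalSpace.mk' E x (mulInvariantVectorField v x) : TangentBundle 𝓘(ℝ, E) G) =
        TotalSpace.mk' E y u := by
    subst hy; rw [← hu]
  refine key _ _ (mul_one x) (Eq.trans ?_ h.symm)
  refine Eq.trans (zero_add _).symm ?_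
  exact congrArg₂ (· + ·) (ContinuousLinearMap.map_zero _).symm rfl

end LeftInvariantFields

section Bracket

variable (E : Type*) [NormedAddCommGroup E] [NormedSpace ℝ E] [FiniteDimensional ℝ E]
  (G : Type*) [TopologicalSpace G] [ChartedSpace E G] [Group G] [LieGroup 𝓘(ℝ, E) ∞ G]

/-- The bracket of the Lie algebra of `G`, as a continuous bilinear map on the model space. -/
noncomputable def groupBracket : E →L[ℝ] E →L[ℝ] E :=
  have : CompleteSpace E := FiniteDimensional.complete ℝ E
  LinearMap.toContinuousBilinearMap
    (LinearMap.mk₂ ℝ (fun v w : E =>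
      @Bracket.bracket (GroupLieAlgebra 𝓘(ℝ, E) G) (GroupLieAlgebra 𝓘(ℝ, E) G) _ v w)
      (fun u v w => add_lie (L := GroupLieAlgebra 𝓘(ℝ, E) G)
        (M := GroupLieAlgebra 𝓘(ℝ, E) G) u v w)
      (fun c v w => smul_lie (L := GroupLieAlgebra 𝓘(ℝ, E) G)
        (M := GroupLieAlgebra 𝓘(ℝ, E) G) c v w)
      (fun u v w => lie_add (L := GroupLieAlgebra 𝓘(ℝ, E) G)
        (M := GroupLieAlgebra 𝓘(ℝ, E) G) u v w)
      (fun c v w => lie_smul (L := GroupLieAlgebra 𝓘(ℝ, E) G)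
        (M := GroupLieAlgebra 𝓘(ℝ, E) G) c v w))

theorem groupBracket_self (v : E) : groupBracket E G v v = 0 :=
  have : CompleteSpace E := FiniteDimensional.complete ℝ E
  lie_self (L := GroupLieAlgebra 𝓘(ℝ, E) G) v

variable {E G}

theorem groupBracket_groupBracket (hG : IsTwoStepNilpotentLieGroup E G) (u v w : E) :
    groupBracket E G (groupBracket E G u v) w = 0 := by
  have : CompleteSpace E := FiniteDimensional.complete ℝ E
  rw [bracket_swap (groupBracket_self E G), neg_eq_zero]
  let g := GroupLieAlgebra 𝓘(ℝ, E) G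
  have h1 : @Bracket.bracket g g _ u v ∈ LieModule.lowerCentralSeries ℝ g g 1 := by
    rw [LieModule.lowerCentralSeries_succ, LieModule.lowerCentralSeries_zero]
    exact LieSubmodule.lie_mem_lie (LieSubmodule.mem_top _) (LieSubmodule.mem_top _)
  have h2 : @Bracket.bracket g g _ w (@Bracket.bracket g g _ u v) ∈ LieModule.lowerCentralSeries ℝ g g 2 := by
    rw [LieModule.lowerCentralSeries_succ]
    exact LieSubmodule.lie_mem_lie (LieSubmodule.mem_top _) h1
  have h3 : LieModule.lowerCentralSeries ℝ g g 2 = ⊥ := hG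
  rw [h3] at h2
  exact h2

theorem mulInvariantVectorField_groupBracket (v w : E) :
    mulInvariantVectorField (I := 𝓘(ℝ, E)) (G := G) (groupBracket E G v w) =
      VectorField.mlieBracket 𝓘(ℝ, E) (mulInvariantVectorField (I := 𝓘(ℝ, E)) (G := G) v)
        (mulInvariantVectorField (I := 𝓘(ℝ, E)) (G := G) w) :=
  have : CompleteSpace E := FiniteDimensional.complete ℝ E
  mulInvariantVector_mlieBracket (I := 𝓘(ℝ, E)) (G := G) v w

end Bracket

/-! ### Left translations and the left-invariant frame in a chart -/

section LeftTranslation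

variable {E : Type*} [NormedAddCommGroup E] [NormedSpace ℝ E]
  {G : Type*} [TopologicalSpace G] [ChartedSpace E G] [Group G]

/-- The derivative at `x` of the left translation by `a`. -/
noncomputable def leftDeriv (a x : G) : E →L[ℝ] E :=
  mfderiv 𝓘(ℝ, E) 𝓘(ℝ, E) (fun y : G => a * y) x

theorem leftDeriv_one (x : G) : leftDeriv 1 x = ContinuousLinearMap.id ℝ E := by
  have h : (fun y : G => 1 * y) = id := funext one_mul
  rw [leftDeriv, h]
  exact mfderiv_id

variable [LieGroup 𝓘(ℝ, E) ∞ G]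

theorem hasMFDerivAt_mul_left' (a x : G) :
    HasMFDerivAt 𝓘(ℝ, E) 𝓘(ℝ, E) (fun y : G => a * y) x (leftDeriv (E := E) a x) :=
  ((contMDiff_mul_left (I := 𝓘(ℝ, E)) (n := ∞)).mdifferentiableAt (by simp)).hasMFDerivAt

theorem leftDeriv_comp (a b x : G) :
    leftDeriv (E := E) a (b * x) ∘L leftDeriv b x = leftDeriv (a * b) x := by
  have h := (hasMFDerivAt_mul_left' (E := E) a (b * x)).comp x (hasMFDerivAt_mul_left' b x)
  have h2 : (fun y : G => a * y) ∘ (fun y => b * y) = fun y => a * b * y := by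
    ext y
    simp [mul_assoc]
  rw [h2] at h
  exact h.mfderiv.symm

theorem leftDeriv_apply_leftDeriv (a x : G) (v : E) :
    leftDeriv a x (leftDeriv x 1 v) = leftDeriv (a * x) 1 v := by
  have h := DFunLike.congr_fun (leftDeriv_comp (E := E) a x 1) v
  rwa [mul_one] at h

theorem isInvertible_leftDeriv (a x : G) : (leftDeriv (E := E) a x).IsInvertible := by
  refine ContinuousLinearMap.IsInvertible.of_inverse (g := leftDeriv a⁻¹ (a * x)) ?_ ?_
  · have h := leftDeriv_comp (E := E) a a⁻¹ (a * x)
    rwa [inv_mul_cancel_left, mul_inv_cancel, leftDeriv_one] at h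
  · rw [leftDeriv_comp, inv_mul_cancel, leftDeriv_one]

end LeftTranslation

section LeftFrame

open VectorField

theorem mlieBracket_modelSpace {E : Type*} [NormedAddCommGroup E] [NormedSpace ℝ E]
    (V W : E → E) (y : E) :
    mlieBracket 𝓘(ℝ, E) V W y = fderiv ℝ W y (V y) - fderiv ℝ V y (W y) :=
  (congrFun (mlieBracketWithin_eq_lieBracketWithin (𝕜 := ℝ) (V := V) (W := W) (s := Set.univ))
    y).trans (congrFun lieBracketWithin_univ y)

variable {E : Type*} [NormedAddCommGroup E] [NormedSpace ℝ E]
  {G : Type*} [TopologicalSpace G] [ChartedSpace E G] [Group G]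

variable (G) in
/-- The derivative of the inverse of the chart at the identity. -/
noncomputable def chartDeriv (y : E) : E →L[ℝ] E :=
  mfderiv 𝓘(ℝ, E) 𝓘(ℝ, E) (extChartAt 𝓘(ℝ, E) (1 : G)).symm y

variable (G) in
/-- The left-invariant vector fields of `G`, in the chart at the identity. -/
noncomputable def leftFrame (y : E) : E →L[ℝ] E :=
  (chartDeriv G y).inverse ∘L leftDeriv ((extChartAt 𝓘(ℝ, E) (1 : G)).symm y) 1

variable [LieGroup 𝓘(ℝ, E) ∞ G] {y : E}

theorem contMDiffAt_extChartAt_symm_one (hy : y ∈ (extChartAt 𝓘(ℝ, E) (1 : G)).target) :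
    ContMDiffAt 𝓘(ℝ, E) 𝓘(ℝ, E) ∞ (extChartAt 𝓘(ℝ, E) (1 : G)).symm y :=
  (contMDiffOn_extChartAt_symm (1 : G)).contMDiffAt
    ((isOpen_extChartAt_target (1 : G)).mem_nhds hy)

theorem hasMFDerivAt_extChartAt_symm_one (hy : y ∈ (extChartAt 𝓘(ℝ, E) (1 : G)).target) :
    HasMFDerivAt 𝓘(ℝ, E) 𝓘(ℝ, E) (extChartAt 𝓘(ℝ, E) (1 : G)).symm y
      (chartDeriv (E := E) G y) :=
  ((contMDiffAt_extChartAt_symm_one hy).mdifferentiableAt (by simp)).hasMFDerivAt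

theorem isInvertible_chartDeriv (hy : y ∈ (extChartAt 𝓘(ℝ, E) (1 : G)).target) :
    (chartDeriv (E := E) G y).IsInvertible := by
  have := isInvertible_mfderivWithin_extChartAt_symm (I := 𝓘(ℝ, E)) (x := (1 : G)) hy
  rwa [modelWithCornersSelf_coe, Set.range_id, mfderivWithin_univ] at this

theorem isInvertible_leftFrame (hy : y ∈ (extChartAt 𝓘(ℝ, E) (1 : G)).target) :
    (leftFrame G y).IsInvertible :=
  (isInvertible_chartDeriv hy).inverse.comp (isInvertible_leftDeriv _ _)

theorem chartDeriv_leftFrame (hy : y ∈ (extChartAt 𝓘(ℝ, E) (1 : G)).target) (v : E) :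
    chartDeriv G y (leftFrame G y v) = leftDeriv ((extChartAt 𝓘(ℝ, E) (1 : G)).symm y) 1 v :=
  (isInvertible_chartDeriv hy).self_apply_inverse _

variable [FiniteDimensional ℝ E]

theorem contDiffOn_leftFrame :
    ContDiffOn ℝ ∞ (leftFrame G) (extChartAt 𝓘(ℝ, E) (1 : G)).target := by
  have : CompleteSpace E := FiniteDimensional.complete ℝ E
  refine contDiffOn_clm_apply.2 fun v => fun y hy => ContDiffAt.contDiffWithinAt ?_
  have h := ContMDiffAt.mpullback_vectorField_preimage (m := ∞) (n := ∞)
    (contMDiff_infty_mulInvariantVectorField (E := E) (G := G) v _)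
    (contMDiffAt_extChartAt_symm_one hy) (isInvertible_chartDeriv (E := E) hy) (by norm_num)
  exact ((contMDiff_snd_tangentBundle_modelSpace E 𝓘(ℝ, E)).contMDiffAt.comp y h).contDiffAt

/-- The relation [Xᵥ, X_w] = X_[v,w] for left-invariant fields, pulled back by the chart, where the
Lie bracket becomes a difference of derivatives. -/
theorem fderiv_leftFrame (hy : y ∈ (extChartAt 𝓘(ℝ, E) (1 : G)).target) (v w : E) :
    fderiv ℝ (leftFrame G) y (leftFrame G y v) w - fderiv ℝ (leftFrame G) y (leftFrame G y w) v =
      leftFrame G y (groupBracket E G v w) := by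
  have : CompleteSpace E := FiniteDimensional.complete ℝ E
  have hd : DifferentiableAt ℝ (leftFrame G) y :=
    (contDiffOn_leftFrame.contDiffAt ((isOpen_extChartAt_target (1 : G)).mem_nhds hy)
      ).differentiableAt (by simp)
  have hv (v a : E) : fderiv ℝ (fun y => leftFrame G y v) y a = fderiv ℝ (leftFrame G) y a v := by
    rw [fderiv_clm_apply hd (differentiableAt_const v)]
    simp
  have h1 := mpullback_mlieBracket (n := ∞)
    (contMDiff_infty_mulInvariantVectorField (E := E) (G := G) v |>.mdifferentiableAt (by simp))
    (contMDiff_infty_mulInvariantVectorField (E := E) (G := G) w |>.mdifferentiableAt (by simp))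
    (contMDiffAt_extChartAt_symm_one hy)
    (by rw [minSmoothness_of_isRCLikeNormedField]; exact ENat.LEInfty.out)
  rw [← mulInvariantVectorField_groupBracket] at h1
  refine Eq.trans ?_ ((mlieBracket_modelSpace (fun y => leftFrame G y v)
    (fun y => leftFrame G y w) y).symm.trans h1.symm)
  rw [hv, hv]

end LeftFrame

/-! ### The Baker-Campbell-Hausdorff group -/

section BCHGroup

variable {E : Type*} [NormedAddCommGroup E] [NormedSpace ℝ E] (β : E →L[ℝ] E →L[ℝ] E)

/-- The Baker-Campbell-Hausdorff product of a two-step nilpotent Lie algebra. -/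
noncomputable def bchMul (x y : E) : E := x + y + (1 / 2 : ℝ) • β x y

/-- A two-step nilpotent Lie algebra with its Baker-Campbell-Hausdorff product is a group. -/
@[reducible]
noncomputable def bchGroup (halt : ∀ x, β x x = 0) (hnil : ∀ x y z, β (β x y) z = 0) : Group E where
  mul := bchMul β
  one := (0 : E)
  inv x := -x
  mul_assoc x y z := by
    change bchMul β (bchMul β x y) z = bchMul β x (bchMul β y z)
    simp only [bchMul, map_add, map_smul, add_apply, FunLike.coe_smul, Pi.smul_apply, hnil,
      bracket_bracket_right halt hnil]
    module
  one_mul x := by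
    change bchMul β 0 x = x
    simp [bchMul]
  mul_one x := by
    change bchMul β x 0 = x
    simp [bchMul]
  inv_mul_cancel x := by
    change bchMul β (-x) x = 0
    simp [bchMul, halt]

end BCHGroup

/-! ### The Maurer-Cartan form and the logarithm of G -/

section MaurerCartanForm

variable {E : Type*} [NormedAddCommGroup E] [NormedSpace ℝ E]
  {G : Type*} [TopologicalSpace G] [ChartedSpace E G] [Group G] [LieGroup 𝓘(ℝ, E) ∞ G]
  [FiniteDimensional ℝ E]

variable (G) in
/-- The Maurer-Cartan form of `G`, in the chart at the identity. -/
noncomputable def maurerCartanForm (y : E) : E →L[ℝ] E := (leftFrame G y).inverse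

theorem contDiffOn_maurerCartanForm :
    ContDiffOn ℝ ∞ (maurerCartanForm G) (extChartAt 𝓘(ℝ, E) (1 : G)).target := by
  have : CompleteSpace E := FiniteDimensional.complete ℝ E
  intro y hy
  exact ((isInvertible_leftFrame hy).contDiffAt_map_inverse.comp y (contDiffOn_leftFrame.contDiffAt
    ((isOpen_extChartAt_target (1 : G)).mem_nhds hy))).contDiffWithinAt

theorem hasFDerivAt_maurerCartanForm {y : E} (hy : y ∈ (extChartAt 𝓘(ℝ, E) (1 : G)).target) :
    HasFDerivAt (maurerCartanForm G) (fderiv ℝ (maurerCartanForm G) y) y :=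
  ((contDiffOn_maurerCartanForm.contDiffAt ((isOpen_extChartAt_target (1 : G)).mem_nhds hy)
    ).differentiableAt (by simp)).hasFDerivAt

/-- The Maurer-Cartan equation, dual to `fderiv_leftFrame`: differentiating the identity form ∘
frame = id expresses the derivative of the form through that of the frame. -/
theorem fderiv_maurerCartanForm {y : E} (hy : y ∈ (extChartAt 𝓘(ℝ, E) (1 : G)).target) (a b : E) :
    fderiv ℝ (maurerCartanForm G) y a b - fderiv ℝ (maurerCartanForm G) y b a =
      -groupBracket E G (maurerCartanForm G y a) (maurerCartanForm G y b) := by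
  have hM : HasFDerivAt (leftFrame G) (fderiv ℝ (leftFrame G) y) y :=
    ((contDiffOn_leftFrame.contDiffAt ((isOpen_extChartAt_target (1 : G)).mem_nhds hy)
      ).differentiableAt (by simp)).hasFDerivAt
  have key (a w : E) : fderiv ℝ (maurerCartanForm G) y a (leftFrame G y w) =
      -maurerCartanForm G y (fderiv ℝ (leftFrame G) y a w) := by
    have h1 := (hasFDerivAt_maurerCartanForm hy).clm_apply
      (hM.clm_apply (hasFDerivAt_const w y))
    have h2 : (fun z => maurerCartanForm G z (leftFrame G z w)) =ᶠ[𝓝 y] fun _ => w := by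
      filter_upwards [(isOpen_extChartAt_target (1 : G)).mem_nhds hy] with z hz
      exact (isInvertible_leftFrame hz).inverse_apply_self w
    have h3 := DFunLike.congr_fun
      (h1.unique ((hasFDerivAt_const w y).congr_of_eventuallyEq h2)) a
    simp only [add_apply, ContinuousLinearMap.comp_apply, ContinuousLinearMap.flip_apply,
      zero_apply, map_zero, zero_add] at h3
    rw [add_comm] at h3
    exact eq_neg_of_add_eq_zero_left h3
  have h4 := fderiv_leftFrame hy (maurerCartanForm G y a) (maurerCartanForm G y b)
  have ha : leftFrame G y (maurerCartanForm G y a) = a :=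
    (isInvertible_leftFrame hy).self_apply_inverse a
  have hb : leftFrame G y (maurerCartanForm G y b) = b :=
    (isInvertible_leftFrame hy).self_apply_inverse b
  have hab := key a (maurerCartanForm G y b)
  have hba := key b (maurerCartanForm G y a)
  rw [ha, hb] at h4
  rw [hb] at hab
  rw [ha] at hba
  have h5 : maurerCartanForm G y (leftFrame G y
      (groupBracket E G (maurerCartanForm G y a) (maurerCartanForm G y b))) =
      groupBracket E G (maurerCartanForm G y a) (maurerCartanForm G y b) :=
    (isInvertible_leftFrame hy).inverse_apply_self _
  rw [hab, hba, ← h5, ← h4, map_sub]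
  abel

/-- `F` satisfies the differential equation of the logarithm at `x`: in the left-invariant
trivialization, its derivative is `v ↦ v + ½ [F x, v]`. -/
def IsLogarithmicAt (F : G → E) (x : G) : Prop :=
  ∃ F' : E →L[ℝ] E, HasMFDerivAt 𝓘(ℝ, E) 𝓘(ℝ, E) F x F' ∧
    ∀ v, F' (leftDeriv x 1 v) = v + (1 / 2 : ℝ) • groupBracket E G (F x) v

theorem IsLogarithmicAt.congr {F₁ F₂ : G → E} {x : G} (h : IsLogarithmicAt F₁ x)
    (he : F₂ =ᶠ[𝓝 x] F₁) : IsLogarithmicAt F₂ x := by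
  obtain ⟨F', h1, h2⟩ := h
  exact ⟨F', h1.congr_of_eventuallyEq he, fun v => by rw [h2, he.self_of_nhds]⟩

theorem IsLogarithmicAt.comp_mul_left {F : G → E} {a x : G} (h : IsLogarithmicAt F (a * x)) :
    IsLogarithmicAt (fun y => F (a * y)) x := by
  obtain ⟨F', h1, h2⟩ := h
  refine ⟨F' ∘L leftDeriv a x, h1.comp x (hasMFDerivAt_mul_left' a x), fun v => ?_⟩
  rw [ContinuousLinearMap.comp_apply, leftDeriv_apply_leftDeriv, h2]

/-- Brackets are central, so (1 + ½ ad c)(v + ½[F, v]) = v + ½[c + F, v], and c + F has the same ad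
as the BCH product of c and F. -/
theorem IsLogarithmicAt.bchMul_left (hG : IsTwoStepNilpotentLieGroup E G) {F : G → E} {x : G}
    (h : IsLogarithmicAt F x) (c : E) :
    IsLogarithmicAt (fun y => bchMul (groupBracket E G) c (F y)) x := by
  obtain ⟨F', h1, h2⟩ := h
  have hb : HasFDerivAt (bchMul (groupBracket E G) c)
      (ContinuousLinearMap.id ℝ E + (1 / 2 : ℝ) • groupBracket E G c) (F x) :=
    ((hasFDerivAt_id _).const_add c).add ((groupBracket E G c).hasFDerivAt.const_smul _)
  refine ⟨(ContinuousLinearMap.id ℝ E + (1 / 2 : ℝ) • groupBracket E G c) ∘L F',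
    hb.hasMFDerivAt.comp x h1, fun v => ?_⟩
  simp only [ContinuousLinearMap.comp_apply, h2, bchMul, add_apply, ContinuousLinearMap.id_apply,
    FunLike.coe_smul, Pi.smul_apply, map_add, map_smul, groupBracket_groupBracket hG,
    bracket_bracket_right (groupBracket_self E G) (groupBracket_groupBracket hG)]
  module

theorem IsLogarithmicAt.hasFDerivAt {F : G → E} {y : E}
    (hy : y ∈ (extChartAt 𝓘(ℝ, E) (1 : G)).target)
    (h : IsLogarithmicAt F ((extChartAt 𝓘(ℝ, E) (1 : G)).symm y)) :
    HasFDerivAt (fun z => F ((extChartAt 𝓘(ℝ, E) (1 : G)).symm z))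
      (maurerCartanForm G y + (1 / 2 : ℝ) • (groupBracket E G
        (F ((extChartAt 𝓘(ℝ, E) (1 : G)).symm y)) ∘L maurerCartanForm G y)) y := by
  obtain ⟨F', h1, h2⟩ := h
  have h3 := (h1.comp y (hasMFDerivAt_extChartAt_symm_one hy)).hasFDerivAt
  refine h3.congr_fderiv ?_
  ext a
  have ha : leftFrame G y (maurerCartanForm G y a) = a :=
    (isInvertible_leftFrame hy).self_apply_inverse a
  have h4 := chartDeriv_leftFrame hy (maurerCartanForm G y a)
  rw [ha] at h4
  change F' (chartDeriv G y a) = _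
  rw [h4, h2]
  rfl

theorem isLogarithmicAt_comp_extChartAt {f : E → E} {x : G}
    (hx : x ∈ (extChartAt 𝓘(ℝ, E) (1 : G)).source)
    (hf : HasFDerivAt f (maurerCartanForm G (extChartAt 𝓘(ℝ, E) (1 : G) x) + (1 / 2 : ℝ) •
      (groupBracket E G (f (extChartAt 𝓘(ℝ, E) (1 : G) x)) ∘L
        maurerCartanForm G (extChartAt 𝓘(ℝ, E) (1 : G) x))) (extChartAt 𝓘(ℝ, E) (1 : G) x)) :
    IsLogarithmicAt (fun z => f (extChartAt 𝓘(ℝ, E) (1 : G) z)) x := by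
  have hy := (extChartAt 𝓘(ℝ, E) (1 : G)).map_source hx
  have hx' := (extChartAt 𝓘(ℝ, E) (1 : G)).left_inv hx
  set y := extChartAt 𝓘(ℝ, E) (1 : G) x with hyx
  have hd : MDifferentiableAt 𝓘(ℝ, E) 𝓘(ℝ, E) (extChartAt 𝓘(ℝ, E) (1 : G)) x :=
    (contMDiffAt_extChartAt' (n := ∞) (by simpa using hx)).mdifferentiableAt (by simp)
  let D : E →L[ℝ] E := mfderiv 𝓘(ℝ, E) 𝓘(ℝ, E) (extChartAt 𝓘(ℝ, E) (1 : G)) x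
  have hD : HasMFDerivAt 𝓘(ℝ, E) 𝓘(ℝ, E) (extChartAt 𝓘(ℝ, E) (1 : G)) x D := hd.hasMFDerivAt
  have hD1 : D ∘L chartDeriv G y = ContinuousLinearMap.id ℝ E := by
    have h1 : HasMFDerivAt 𝓘(ℝ, E) 𝓘(ℝ, E) (extChartAt 𝓘(ℝ, E) (1 : G))
      ((extChartAt 𝓘(ℝ, E) (1 : G)).symm y) D := by rw [hx']; exact hD
    have h2 : HasFDerivAt (extChartAt 𝓘(ℝ, E) (1 : G) ∘ (extChartAt 𝓘(ℝ, E) (1 : G)).symm)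
      (D ∘L chartDeriv G y) y := (h1.comp y (hasMFDerivAt_extChartAt_symm_one hy)).hasFDerivAt
    refine (h2.congr_of_eventuallyEq ?_).unique (hasFDerivAt_id y)
    filter_upwards [(isOpen_extChartAt_target (1 : G)).mem_nhds hy] with z hz
    exact ((extChartAt 𝓘(ℝ, E) (1 : G)).right_inv hz).symm
  refine ⟨_, hf.hasMFDerivAt.comp x hD, fun v => ?_⟩
  have h3 : D (leftDeriv x 1 v) = leftFrame G y v := by
    have h4 := chartDeriv_leftFrame hy v
    rw [hx'] at h4
    rw [← h4]
    exact DFunLike.congr_fun hD1 _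
  have h5 : maurerCartanForm G y (leftFrame G y v) = v :=
    (isInvertible_leftFrame hy).inverse_apply_self v
  change maurerCartanForm G y (D (leftDeriv x 1 v)) + (1 / 2 : ℝ) • groupBracket E G (f y)
    (maurerCartanForm G y (D (leftDeriv x 1 v))) = _
  rw [h3, h5]

theorem exists_isLogarithmicAt (hG : IsTwoStepNilpotentLieGroup E G) :
    ∃ (U : Set G) (ψ : G → E), IsOpen U ∧ 1 ∈ U ∧ ψ 1 = 0 ∧
      ContMDiffOn 𝓘(ℝ, E) 𝓘(ℝ, E) ∞ ψ U ∧ ∀ x ∈ U, IsLogarithmicAt ψ x := by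
  have : CompleteSpace E := FiniteDimensional.complete ℝ E
  -- A ball in the chart is convex, as the Poincaré lemma requires.
  obtain ⟨r, hr, hball⟩ := Metric.isOpen_iff.1 (isOpen_extChartAt_target (I := 𝓘(ℝ, E)) (1 : G)) _
    (mem_extChartAt_target (1 : G))
  set s := Metric.ball (extChartAt 𝓘(ℝ, E) (1 : G) 1) r
  obtain ⟨f, hf0, hf, hfs⟩ := exists_logarithm (groupBracket_self E G)
    (groupBracket_groupBracket hG) (convex_ball _ r) Metric.isOpen_ball (Metric.mem_ball_self hr)
    (contDiffOn_maurerCartanForm.mono hball) (fun y hy => hasFDerivAt_maurerCartanForm (hball hy))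
    (fun y hy => fderiv_maurerCartanForm (hball hy))
  refine ⟨(extChartAt 𝓘(ℝ, E) (1 : G)).source ∩ extChartAt 𝓘(ℝ, E) (1 : G) ⁻¹' s,
    fun x => f (extChartAt 𝓘(ℝ, E) (1 : G) x), isOpen_extChartAt_preimage' _ Metric.isOpen_ball,
    ⟨mem_extChartAt_source _, Metric.mem_ball_self hr⟩, hf0, ?_,
    fun x hx => isLogarithmicAt_comp_extChartAt hx.1 (hf _ hx.2)⟩
  exact hfs.contMDiffOn.comp (contMDiffOn_extChartAt.mono (by simp)) (fun x hx => hx.2)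

theorem IsLogarithmicAt.eventuallyEq (hG : IsTwoStepNilpotentLieGroup E G) {F₁ F₂ : G → E}
    (h₁ : ∀ᶠ x in 𝓝 1, IsLogarithmicAt F₁ x) (h₂ : ∀ᶠ x in 𝓝 1, IsLogarithmicAt F₂ x)
    (h : F₁ 1 = F₂ 1) : F₁ =ᶠ[𝓝 1] F₂ := by
  have hc := (contMDiffAt_extChartAt_symm_one (mem_extChartAt_target (I := 𝓘(ℝ, E)) (1 : G))
    ).continuousAt
  rw [ContinuousAt, extChartAt_to_inv] at hc
  have ht := (isOpen_extChartAt_target (I := 𝓘(ℝ, E)) (1 : G)).mem_nhds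
    (mem_extChartAt_target (1 : G))
  obtain ⟨r, hr, hball⟩ := Metric.mem_nhds_iff.1
    (Filter.inter_mem ht (hc.eventually (h₁.and h₂)))
  have heq := eqOn_of_logarithmic_equation (groupBracket_groupBracket hG)
    (convex_ball _ r).isPreconnected Metric.isOpen_ball
    (fun y hy => (hball hy).2.1.hasFDerivAt (hball hy).1)
    (fun y hy => (hball hy).2.2.hasFDerivAt (hball hy).1)
    (Metric.mem_ball_self hr) (by simpa using h)
  filter_upwards [(continuousAt_extChartAt (I := 𝓘(ℝ, E)) (1 : G)).preimage_mem_nhds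
    (Metric.ball_mem_nhds _ hr), extChartAt_source_mem_nhds (I := 𝓘(ℝ, E)) (1 : G)] with x hx hx'
  have := heq hx
  simpa only [(extChartAt 𝓘(ℝ, E) (1 : G)).left_inv hx'] using this

/-- A simply connected two-step nilpotent Lie group has a global logarithm. -/
theorem exists_global_logarithm [SimplyConnectedSpace G] (hG : IsTwoStepNilpotentLieGroup E G) :
    ∃ Ψ : G → E, ContMDiff 𝓘(ℝ, E) 𝓘(ℝ, E) ∞ Ψ ∧ Ψ 1 = 0 ∧
      (∀ x y, Ψ (x * y) = bchMul (groupBracket E G) (Ψ x) (Ψ y)) ∧ ∀ x, IsLogarithmicAt Ψ x := by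
  have : IsTopologicalGroup G := topologicalGroup_of_lieGroup 𝓘(ℝ, E) ∞
  have : LocallyPathConnectedSpace G := ChartedSpace.locallyPathConnectedSpace E G
  obtain ⟨U, ψ, hU, h1, hψ1, hs, hlog⟩ := exists_isLogarithmicAt hG
  let _ : Group E := bchGroup (groupBracket E G) (groupBracket_self E G)
    (groupBracket_groupBracket hG)
  -- As functions of w both sides solve the logarithmic equation, which is invariant under left
  -- translation in G and in the BCH group; they agree at w = 1.
  have hloc : ∀ u ∈ U, ∀ᶠ w in 𝓝 1, ψ (u * w) = bchMul (groupBracket E G) (ψ u) (ψ w) := by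
    intro u hu
    refine IsLogarithmicAt.eventuallyEq hG ?_ ?_ (by simp [hψ1, bchMul])
    · filter_upwards [eventually_mul_left_nhds (hU.mem_nhds hu)] with w hw
      exact (hlog _ hw).comp_mul_left
    · filter_upwards [hU.mem_nhds h1] with w hw
      exact (hlog w hw).bchMul_left hG _
  obtain ⟨Ψ, hΨ⟩ := exists_monoidHom_eventuallyEq hU h1 ψ hloc
  have hmul (x y : G) : Ψ (x * y) = bchMul (groupBracket E G) (Ψ x) (Ψ y) := map_mul Ψ x y
  -- The extension carries no regularity of its own; smoothness and the differential equation are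
  -- transported from 1 to a by translation.
  have hnear (a : G) : Ψ =ᶠ[𝓝 a] fun x => bchMul (groupBracket E G) (Ψ a) (ψ (a⁻¹ * x)) := by
    filter_upwards [eventually_inv_mul_nhds a hΨ] with x hx
    rw [← hx, ← hmul, mul_inv_cancel_left]
  refine ⟨Ψ, fun a => ?_, map_one Ψ, hmul, fun a => ?_⟩
  · refine ContMDiffAt.congr_of_eventuallyEq ?_ (hnear a)
    have h2 : ContMDiffAt 𝓘(ℝ, E) 𝓘(ℝ, E) ∞ (fun x => ψ (a⁻¹ * x)) a := by
      refine ContMDiffAt.comp a ?_ (contMDiff_mul_left (I := 𝓘(ℝ, E))).contMDiffAt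
      rw [inv_mul_cancel]
      exact hs.contMDiffAt (hU.mem_nhds h1)
    have h3 : ContDiff ℝ ∞ (bchMul (groupBracket E G) (Ψ a)) :=
      (contDiff_const.add contDiff_id).add (contDiff_const.smul (groupBracket E G (Ψ a)).contDiff)
    exact h3.contMDiff.contMDiffAt.comp a h2
  · refine IsLogarithmicAt.congr ?_ (hnear a)
    refine IsLogarithmicAt.comp_mul_left (F := fun x => bchMul (groupBracket E G) (Ψ a) (ψ x))
      (IsLogarithmicAt.bchMul_left hG ?_ _)
    rw [inv_mul_cancel]
    exact hlog 1 h1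

end MaurerCartanForm

/-! ### The logarithm is an embedding -/

section Embedding

variable {E : Type*} [NormedAddCommGroup E] [NormedSpace ℝ E]

theorem continuous_bchMul (β : E →L[ℝ] E →L[ℝ] E) (c : E) : Continuous (bchMul β c) :=
  (continuous_const.add continuous_id).add ((β c).continuous.const_smul _)

section Topological

variable {G : Type*} [TopologicalSpace G] [Group G] [IsTopologicalGroup G]
  {β : E →L[ℝ] E →L[ℝ] E} {Ψ : G → E} {σ : E → G} {r : ℝ}

/-- Translating σ gives, near every Ψ a, a continuous local right inverse of Ψ that sends Ψ a to a.
-/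
theorem isOpenMap_of_local_section (halt : ∀ x, β x x = 0) (hnil : ∀ x y z, β (β x y) z = 0)
    (hmul : ∀ x y, Ψ (x * y) = bchMul β (Ψ x) (Ψ y)) (hr : 0 < r)
    (hσ : ContinuousOn σ (Metric.ball 0 r)) (hσ0 : σ 0 = 1)
    (hσΨ : ∀ X ∈ Metric.ball 0 r, Ψ (σ X) = X) : IsOpenMap Ψ := by
  let _ : Group E := bchGroup β halt hnil
  refine IsOpenMap.of_nhds_le fun a => ?_
  have hself : bchMul β (-Ψ a) (Ψ a) = 0 := by simp [bchMul, halt]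
  have hc : ContinuousAt (bchMul β (-Ψ a)) (Ψ a) := (continuous_bchMul β _).continuousAt
  have hball : Metric.ball (0 : E) r ∈ 𝓝 (bchMul β (-Ψ a) (Ψ a)) := by
    rw [hself]; exact Metric.ball_mem_nhds _ hr
  have hlim : Filter.Tendsto (fun Y => a * σ (bchMul β (-Ψ a) Y)) (𝓝 (Ψ a)) (𝓝 a) := by
    have h1 : ContinuousAt (fun Y => a * σ (bchMul β (-Ψ a) Y)) (Ψ a) :=
      continuousAt_const.mul (ContinuousAt.comp (hσ.continuousAt hball) hc)
    have h2 : a * σ (bchMul β (-Ψ a) (Ψ a)) = a := by rw [hself, hσ0, mul_one]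
    have h3 := h1.tendsto
    rwa [h2] at h3
  have hright : (fun Y => Ψ (a * σ (bchMul β (-Ψ a) Y))) =ᶠ[𝓝 (Ψ a)] id := by
    filter_upwards [hc.preimage_mem_nhds hball] with Y hY
    rw [hmul, hσΨ _ hY]
    exact mul_inv_cancel_left (G := E) (Ψ a) Y
  calc 𝓝 (Ψ a) = Filter.map (fun Y => Ψ (a * σ (bchMul β (-Ψ a) Y))) (𝓝 (Ψ a)) := by
        rw [Filter.map_congr hright, Filter.map_id]
    _ = Filter.map Ψ (Filter.map (fun Y => a * σ (bchMul β (-Ψ a) Y)) (𝓝 (Ψ a))) := rfl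
    _ ≤ Filter.map Ψ (𝓝 a) := Filter.map_mono hlim

/-- The kernel is discrete, and a path from 1 to a kernel element can be corrected to a path inside
the kernel, which must be constant. -/
theorem injective_of_local_section [PathConnectedSpace G]
    (halt : ∀ x, β x x = 0) (hnil : ∀ x y z, β (β x y) z = 0) (hΨ : Continuous Ψ)
    (hmul : ∀ x y, Ψ (x * y) = bchMul β (Ψ x) (Ψ y)) (hr : 0 < r)
    (hσ : ContinuousOn σ (Metric.ball 0 r)) (hσ0 : σ 0 = 1)
    (hσΨ : ∀ X ∈ Metric.ball 0 r, Ψ (σ X) = X) (hker : ∀ᶠ x in 𝓝 1, Ψ x = 0 → x = 1) :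
    Function.Injective Ψ := by
  let _ : Group E := bchGroup β halt hnil
  let Φ : G →* E := MonoidHom.mk' Ψ hmul
  -- BCH powers are multiples because [kX, X] = 0. Thus X ↦ σ (X / k) ^ k is a section of Ψ on a
  -- ball k times larger.
  have hpow (x : G) (k : ℕ) : Ψ (x ^ k) = k • Ψ x := by
    induction k with
    | zero =>
      rw [pow_zero, zero_smul]
      exact map_one Φ
    | succ k ih =>
      rw [pow_succ, hmul, ih, bchMul, map_nsmul]
      simp [halt, add_smul]
  suffices h : ∀ x, Ψ x = 0 → x = 1 from
    (injective_iff_map_eq_one Φ).2 h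
  intro x hx
  obtain ⟨γ⟩ := PathConnectedSpace.joined (1 : G) x
  obtain ⟨R, hR⟩ := (isCompact_range (hΨ.comp γ.continuous)).isBounded.subset_ball 0
  obtain ⟨k, hk⟩ := exists_nat_gt (R / r)
  have hR0 : 0 < R := by
    have := hR ⟨0, rfl⟩
    exact Metric.pos_of_mem_ball this
  have hk0 : (0 : ℝ) < k := (div_pos hR0 hr).trans hk
  have hmem (t : unitInterval) : (k : ℝ)⁻¹ • Ψ (γ t) ∈ Metric.ball (0 : E) r := by
    have h1 : ‖Ψ (γ t)‖ < R := mem_ball_zero_iff.1 (hR ⟨t, rfl⟩)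
    rw [mem_ball_zero_iff, norm_smul, norm_inv, Real.norm_natCast, inv_mul_lt_iff₀ hk0]
    rw [div_lt_iff₀ hr] at hk
    exact h1.trans hk
  -- The enlarged section applied to Ψ ∘ γ has the same image as γ under Ψ, so the quotient δ stays
  -- in the kernel. It runs from 1 to x, since σ 0 = 1 and Ψ vanishes at both ends.
  let δ : unitInterval → G := fun t => (σ ((k : ℝ)⁻¹ • Ψ (γ t)) ^ k)⁻¹ * γ t
  have hδc : Continuous δ :=
    ((hσ.comp_continuous ((hΨ.comp γ.continuous).const_smul _) hmem).pow k).inv.mul γ.continuous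
  have hδΨ (t : unitInterval) : Φ (δ t) = 1 := by
    have h1 : Φ (σ ((k : ℝ)⁻¹ • Ψ (γ t)) ^ k) = Φ (γ t) := by
      change Ψ _ = Ψ _
      rw [hpow, hσΨ _ (hmem t), ← Nat.cast_smul_eq_nsmul ℝ, smul_inv_smul₀ hk0.ne']
    rw [map_mul, map_inv, h1, inv_mul_cancel]
  have hloc : IsLocallyConstant δ := by
    rw [IsLocallyConstant.iff_eventually_eq]
    intro t
    filter_upwards [hδc.continuousAt.eventually (eventually_inv_mul_nhds (δ t) hker)] with s hs
    have : Φ ((δ t)⁻¹ * δ s) = 1 := by rw [map_mul, map_inv, hδΨ, hδΨ, inv_mul_cancel]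
    exact (inv_mul_eq_one.1 (hs this)).symm
  have h01 := hloc.apply_eq_of_preconnectedSpace 1 0
  have hΨ1 : Ψ 1 = 0 := map_one Φ
  simpa [δ, hΨ1, hx, hσ0] using h01

end Topological

variable [FiniteDimensional ℝ E]
  {G : Type*} [TopologicalSpace G] [ChartedSpace E G] [Group G] [LieGroup 𝓘(ℝ, E) ∞ G]

theorem isEmbedding_of_isLogarithmicAt [SimplyConnectedSpace G]
    (hG : IsTwoStepNilpotentLieGroup E G) {Ψ : G → E} (hΨ : ContMDiff 𝓘(ℝ, E) 𝓘(ℝ, E) ∞ Ψ)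
    (hΨ1 : Ψ 1 = 0) (hmul : ∀ x y, Ψ (x * y) = bchMul (groupBracket E G) (Ψ x) (Ψ y))
    (hlog : IsLogarithmicAt Ψ 1) : Topology.IsEmbedding Ψ := by
  have : CompleteSpace E := FiniteDimensional.complete ℝ E
  have : IsTopologicalGroup G := topologicalGroup_of_lieGroup 𝓘(ℝ, E) ∞
  set χ := extChartAt 𝓘(ℝ, E) (1 : G)
  have hy := mem_extChartAt_target (I := 𝓘(ℝ, E)) (1 : G)
  have hinv : χ.symm (χ 1) = 1 := extChartAt_to_inv (1 : G)
  let f : E → E := fun y => Ψ (χ.symm y)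
  have hf1 : f (χ 1) = 0 := by simp only [f, hinv, hΨ1]
  obtain ⟨A, hA⟩ := (isInvertible_leftFrame hy).inverse
  -- At 1 the bracket term drops out because Ψ 1 = 0, leaving the invertible Maurer-Cartan form.
  have hf' : HasFDerivAt f (A : E →L[ℝ] E) (χ 1) := by
    have h := IsLogarithmicAt.hasFDerivAt (F := Ψ) hy (by rw [hinv]; exact hlog)
    rw [hinv, hΨ1] at h
    rw [map_zero, ContinuousLinearMap.zero_comp, smul_zero, add_zero] at h
    rw [hA]
    exact h
  have hfc : ContDiffAt ℝ ∞ f (χ 1) :=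
    (hΨ.contMDiffAt.comp (χ 1) (contMDiffAt_extChartAt_symm_one hy)).contDiffAt
  let e := hfc.toOpenPartialHomeomorph f hf' (by simp)
  have hes : χ 1 ∈ e.source := hfc.mem_toOpenPartialHomeomorph_source hf' (by simp)
  have het : (0 : E) ∈ e.target := hf1 ▸ e.map_source hes
  have he0 : e.symm 0 = χ 1 := by
    have h : e.symm (f (χ 1)) = χ 1 := e.left_inv hes
    rwa [hf1] at h
  have hnhds : e.target ∩ e.symm ⁻¹' χ.target ∈ 𝓝 (0 : E) := by
    refine Filter.inter_mem (e.open_target.mem_nhds het)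
      ((e.continuousAt_symm het).preimage_mem_nhds ?_)
    rw [he0]
    exact (isOpen_extChartAt_target (1 : G)).mem_nhds hy
  obtain ⟨r, hr, hball⟩ := Metric.mem_nhds_iff.1 hnhds
  have hσ : ContinuousOn (fun X => χ.symm (e.symm X)) (Metric.ball 0 r) :=
    (continuousOn_extChartAt_symm (1 : G)).comp
      (e.continuousOn_symm.mono fun X hX => (hball hX).1) fun X hX => (hball hX).2
  have hσ0 : χ.symm (e.symm 0) = 1 := by rw [he0, hinv]
  have hσΨ : ∀ X ∈ Metric.ball 0 r, Ψ (χ.symm (e.symm X)) = X := fun X hX =>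
    e.right_inv (hball hX).1
  have hker : ∀ᶠ x in 𝓝 1, Ψ x = 0 → x = 1 := by
    filter_upwards [(continuousAt_extChartAt (I := 𝓘(ℝ, E)) (1 : G)).preimage_mem_nhds
      (e.open_source.mem_nhds hes), extChartAt_source_mem_nhds (I := 𝓘(ℝ, E)) (1 : G)] with x h1 h2 hx
    refine χ.injOn h2 (mem_extChartAt_source (1 : G)) (e.injOn h1 hes ?_)
    change Ψ (χ.symm (χ x)) = f (χ 1)
    rw [χ.left_inv h2, hx, hf1]
  exact (Topology.IsOpenEmbedding.of_continuous_injective_isOpenMap hΨ.continuous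
    (injective_of_local_section (groupBracket_self E G) (groupBracket_groupBracket hG)
      hΨ.continuous hmul hr hσ hσ0 hσΨ hker)
    (isOpenMap_of_local_section (groupBracket_self E G) (groupBracket_groupBracket hG)
      hmul hr hσ hσ0 hσΨ)).isEmbedding

end Embedding

/-! ### Matrix representations and sums of squares -/

section Representation

theorem einsteinForm_of_strictlyLower {n : ℕ} {A B : lowerTriangular n}
    (hA : ∀ i j, i ≤ j → A.1 i j = 0) :
    einsteinForm n A B = ∑ i, ∑ j, A.1 i j * B.1 i j := by
  rw [einsteinForm_apply, Finset.sum_eq_zero (fun i _ => by rw [hA i i le_rfl, zero_mul]),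
    mul_zero, zero_add]
  refine Finset.sum_congr rfl fun i _ => Finset.sum_subset (Finset.subset_univ _) fun j _ hj => ?_
  rw [hA i j (by simpa using hj), zero_mul]

variable {V : Type*} [AddCommGroup V] [Module ℝ V]

/-- A strictly lower triangular matrix representation, with respect to an enumeration `e` of the
index set, as a map into the algebra of lower triangular matrices. -/
def lowerTriangularOfMatrix {I : Type*} {n : ℕ} (e : I ≃ Fin n) (R : V →ₗ[ℝ] Matrix I I ℝ)
    (hR : ∀ X a b, e a ≤ e b → R X a b = 0) : V →ₗ[ℝ] lowerTriangular n where
  toFun X := ⟨(R X).submatrix e.symm e.symm, fun i j hij => hR _ _ _ (by simpa using hij.le)⟩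
  map_add' X Y := Subtype.ext (by simp [Matrix.submatrix_add])
  map_smul' a X := Subtype.ext (by simp [Matrix.submatrix_smul])

open scoped MatrixOrder Matrix.Norms.L2Operator in
/-- A positive semidefinite form is a sum of squares of linear functionals. -/
theorem exists_sum_mul_eq {ι : Type*} [Fintype ι] [DecidableEq ι] (b : Module.Basis ι ℝ V)
    (S : V →ₗ[ℝ] V →ₗ[ℝ] ℝ) (hsymm : ∀ X Y, S X Y = S Y X) (hpos : ∀ X, 0 ≤ S X X) :
    ∃ L : V →ₗ[ℝ] (ι → ℝ), ∀ X Y, ∑ k, L X k * L Y k = S X Y := by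
  have hS (X Y : V) : b.repr X ⬝ᵥ (LinearMap.BilinForm.toMatrix b S).mulVec (b.repr Y) = S X Y :=
    (LinearMap.BilinForm.apply_eq_dotProduct_toMatrix_mulVec b S X Y).symm
  have hps : (LinearMap.BilinForm.toMatrix b S).PosSemidef := by
    refine Matrix.PosSemidef.of_dotProduct_mulVec_nonneg ?_ fun x => ?_
    · ext i j
      simp [LinearMap.BilinForm.toMatrix_apply, hsymm (b i) (b j)]
    · have := hS (b.equivFun.symm x) (b.equivFun.symm x)
      rw [← Module.Basis.equivFun_apply, LinearEquiv.apply_symm_apply] at this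
      rw [star_trivial]
      exact this.symm ▸ hpos _
  -- The Gram matrix factors as RᵀR; the rows of R are the required functionals.
  obtain ⟨R, hR⟩ := CStarAlgebra.nonneg_iff_eq_star_mul_self.1 hps.nonneg
  refine ⟨R.mulVecLin ∘ₗ b.equivFun.toLinearMap, fun X Y => ?_⟩
  rw [← hS, hR, Matrix.star_eq_conjTranspose, Matrix.conjTranspose_eq_transpose_of_trivial,
    ← Matrix.mulVec_mulVec,
    Matrix.dotProduct_mulVec, Matrix.vecMul_transpose]
  rfl

end Representation

/-! ### The isometric representation -/

section EuclideanRepresentation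

open scoped InnerProductSpace

/-- The block matrix with first column `(a, z)` below a zero, and with a second block column `B`. -/
def blockMatrix {κ ι : Type*} (a : κ → ℝ) (z : ι → ℝ) (B : ι → κ → ℝ) :
    Matrix (Fin 1 ⊕ κ ⊕ ι) (Fin 1 ⊕ κ ⊕ ι) ℝ :=
  Matrix.of fun x y => match x, y with
    | .inr (.inl k), .inl _ => a k
    | .inr (.inr i), .inl _ => z i
    | .inr (.inr i), .inr (.inl k) => B i k
    | _, _ => 0

theorem blockMatrix_mul {κ ι : Type*} [Fintype κ] [Fintype ι] (a a' : κ → ℝ) (z z' : ι → ℝ)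
    (B B' : ι → κ → ℝ) : blockMatrix a z B * blockMatrix a' z' B' =
      blockMatrix 0 (fun i => ∑ k, B i k * a' k) 0 := by
  ext x y
  rw [Matrix.mul_apply]
  rcases x with x | x | x <;> rcases y with y | y | y <;>
    simp [blockMatrix, Fintype.sum_sum_type]

theorem sum_blockMatrix {κ ι : Type*} [Fintype κ] [Fintype ι] (a a' : κ → ℝ) (z z' : ι → ℝ)
    (B B' : ι → κ → ℝ) : ∑ x, ∑ y, blockMatrix a z B x y * blockMatrix a' z' B' x y =
      ∑ k, a k * a' k + ∑ i, z i * z' i + ∑ i, ∑ k, B i k * B' i k := by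
  simp [blockMatrix, Fintype.sum_sum_type, Finset.sum_add_distrib, add_assoc]

/-- The enumeration of the index set of a block matrix. -/
noncomputable def blockEquiv (κ : Type*) [Fintype κ] (d : ℕ) :
    Fin 1 ⊕ κ ⊕ Fin d ≃ Fin (1 + (Fintype.card κ + d)) :=
  ((Equiv.refl _).sumCongr (((Fintype.equivFin κ).sumCongr (Equiv.refl _)).trans
    finSumFinEquiv)).trans finSumFinEquiv

/-- The enumeration lists the single index first, then κ, then `Fin d`, so each nonzero block lies
strictly below the diagonal. -/
theorem blockMatrix_eq_zero {κ : Type*} [Fintype κ] {d : ℕ} (a : κ → ℝ) (z : Fin d → ℝ)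
    (B : Fin d → κ → ℝ) (x y) (h : blockEquiv κ d x ≤ blockEquiv κ d y) :
    blockMatrix a z B x y = 0 := by
  rw [Fin.le_def] at h
  rcases x with x | x | x <;> rcases y with y | y | y <;>
    (simp [blockMatrix, blockEquiv] at h ⊢; try omega)

/-- Reduces the construction to three linear maps: a product of block matrices has only the corner B
a', so `ha`, `hB` and `hz` together say exactly that it is half the matrix of the bracket. -/
theorem exists_representation_of_maps {V : Type*} [AddCommGroup V] [Module ℝ V] {κ : Type*}
    [Fintype κ] {d : ℕ}
    (β : V → V → V)
    (a : V →ₗ[ℝ] κ → ℝ) (z : V →ₗ[ℝ] Fin d → ℝ) (B : V →ₗ[ℝ] Fin d → κ → ℝ)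
    (ha : ∀ X Y, a (β X Y) = 0) (hB : ∀ X Y, B (β X Y) = 0)
    (hz : ∀ X Y i, ∑ k, B X i k * a Y k = (1 / 2 : ℝ) * z (β X Y) i) :
    ∃ (n : ℕ) (r : V →ₗ[ℝ] lowerTriangular n), (∀ X i, (r X).1 i i = 0) ∧
      (∀ X Y, r X * r Y = (1 / 2 : ℝ) • r (β X Y)) ∧
      ∀ X Y, einsteinForm n (r X) (r Y) =
        ∑ k, a X k * a Y k + ∑ i, z X i * z Y i + ∑ i, ∑ k, B X i k * B Y i k := by
  let R : V →ₗ[ℝ] Matrix (Fin 1 ⊕ κ ⊕ Fin d) (Fin 1 ⊕ κ ⊕ Fin d) ℝ :=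
    { toFun := fun X => blockMatrix (a X) (z X) (B X)
      map_add' := fun X Y => by
        ext x y
        rcases x with x | x | x <;> rcases y with y | y | y <;> simp [blockMatrix]
      map_smul' := fun c X => by
        ext x y
        rcases x with x | x | x <;> rcases y with y | y | y <;> simp [blockMatrix] }
  have hR : ∀ X x y, blockEquiv κ d x ≤ blockEquiv κ d y → R X x y = 0 :=
    fun X => blockMatrix_eq_zero _ _ _
  refine ⟨_, lowerTriangularOfMatrix (blockEquiv κ d) R hR, fun X i => hR _ _ _ le_rfl,
    fun X Y => Subtype.ext ?_, fun X Y => ?_⟩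
  · change (R X).submatrix _ _ * (R Y).submatrix _ _ = (1 / 2 : ℝ) • (R (β X Y)).submatrix _ _
    rw [Matrix.submatrix_mul_equiv]
    refine congrArg (fun A => Matrix.submatrix A (blockEquiv κ d).symm (blockEquiv κ d).symm)
      (a₂ := (1 / 2 : ℝ) • R (β X Y)) ?_
    change blockMatrix _ _ _ * blockMatrix _ _ _ = (1 / 2 : ℝ) • blockMatrix _ _ _
    rw [blockMatrix_mul, ha, hB]
    ext x y
    rcases x with x | x | x <;> rcases y with y | y | y <;> simp [blockMatrix]
    simpa using hz X Y x
  · rw [einsteinForm_of_strictlyLower (fun i j hij => hR _ _ _ (by simpa using hij)),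
      ← sum_blockMatrix, ← (blockEquiv κ d).sum_comp]
    refine Finset.sum_congr rfl fun x _ => ?_
    rw [← (blockEquiv κ d).sum_comp]
    refine Finset.sum_congr rfl fun y _ => ?_
    change R X _ _ * R Y _ _ = R X _ _ * R Y _ _
    simp

/-- With p and q the projections onto the derived algebra and its complement, take a = (s q, 2s L),
z = 2s p and B = (ad, 0). The squared norm is s²|q|² + 4s²|L|² + 4s²|p|² + |ad|², and L is chosen to
make this 4s² times the given one. -/
theorem exists_representation_of_orthonormalBasis {V : Type*} [NormedAddCommGroup V]
    [InnerProductSpace ℝ V] [FiniteDimensional ℝ V] {d : ℕ} (o : OrthonormalBasis (Fin d) ℝ V)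
    (β : V →ₗ[ℝ] V →ₗ[ℝ] V)
    (halt : ∀ X, β X X = 0) (hnil : ∀ X Y Z, β (β X Y) Z = 0) :
    ∃ (n : ℕ) (c : ℝ) (r : V →ₗ[ℝ] lowerTriangular n), 0 < c ∧
      (∀ X i, (r X).1 i i = 0) ∧ (∀ X Y, r X * r Y = (1 / 2 : ℝ) • r (β X Y)) ∧
      ∀ X Y, c * einsteinForm n (r X) (r Y) = ⟪X, Y⟫_ℝ := by
  let Z : Submodule ℝ V := Submodule.span ℝ {z | ∃ X Y, β X Y = z}
  let p : V →ₗ[ℝ] V := Z.starProjection.toLinearMap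
  let q : V →ₗ[ℝ] V := LinearMap.id - p
  have hq (X : V) : q X = X - p X := rfl
  have hβZ : ∀ z ∈ Z, β z = 0 := by
    intro z hz
    have h : Z ≤ LinearMap.ker β := Submodule.span_le.2 (by
      rintro _ ⟨X, Y, rfl⟩
      exact LinearMap.ext fun W => hnil X Y W)
    exact h hz
  have hpβ (X Y : V) : p (β X Y) = β X Y :=
    Submodule.starProjection_eq_self_iff.2 (Submodule.subset_span ⟨X, Y, rfl⟩)
  have hqβ (X Y : V) : q (β X Y) = 0 := by rw [hq, hpβ, sub_self]
  have hβq (X : V) : β (q X) = β X := by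
    rw [hq, map_sub, hβZ (p X) (Submodule.starProjection_apply_mem Z X), sub_zero]
  have hswap (X Y : V) : β X Y = -β Y X := by
    have := halt (X + Y)
    simp only [map_add, LinearMap.add_apply, halt, zero_add, add_zero] at this
    exact eq_neg_of_add_eq_zero_right this
  have hβq' (X Y : V) : β X (q Y) = β X Y := by rw [hswap, hβq, ← hswap]
  have hpq (X Y : V) : ⟪p X, p Y⟫_ℝ + ⟪q X, q Y⟫_ℝ = ⟪X, Y⟫_ℝ := by
    have h (X Y : V) : ⟪p X, q Y⟫_ℝ = 0 :=
      Submodule.inner_right_of_mem_orthogonal (Submodule.starProjection_apply_mem Z X)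
        (Submodule.sub_starProjection_mem_orthogonal Y)
    have h1 := h X Y
    have h2 := h Y X
    rw [real_inner_comm] at h2
    have hX : X = p X + q X := by rw [hq]; abel
    have hY : Y = p Y + q Y := by rw [hq]; abel
    conv_rhs => rw [hX, hY]
    rw [inner_add_left, inner_add_right, inner_add_right, h1, h2]
    ring
  let D : V →ₗ[ℝ] V →ₗ[ℝ] ℝ := ∑ i, (innerₗ V).compl₁₂ (β.flip (o i)) (β.flip (o i))
  have hD (X Y : V) : D X Y = ∑ i, ⟪β X (o i), β Y (o i)⟫_ℝ := by simp [D]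
  obtain ⟨K, hK0, hK⟩ : ∃ K : ℝ, 0 ≤ K ∧ ∀ X, D X X ≤ K * ‖X‖ ^ 2 := by
    refine ⟨‖LinearMap.toContinuousBilinearMap D‖,
      ContinuousLinearMap.opNorm_nonneg _, fun X => ?_⟩
    have := (LinearMap.toContinuousBilinearMap D).le_opNorm₂ X X
    rw [pow_two, ← mul_assoc]
    exact (le_abs_self _).trans this
  -- Any s > 0 with K ≤ 3s² would do; this makes `S` below positive semidefinite.
  let s : ℝ := K + 1
  have hs : 0 < s := by positivity
  -- The metric defect: s²|q|² + 4s² S + D = 4s²|q|², where D is the Hilbert-Schmidt form of ad.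
  let S : V →ₗ[ℝ] V →ₗ[ℝ] ℝ :=
    (3 / 4 : ℝ) • (innerₗ V).compl₁₂ q q - (1 / (4 * s ^ 2)) • D
  have hS (X Y : V) : S X Y = 3 / 4 * ⟪q X, q Y⟫_ℝ - 1 / (4 * s ^ 2) * D X Y := by simp [S]
  have hDq (X : V) : D X X ≤ K * ‖q X‖ ^ 2 := by
    have h := hK (q X)
    rw [hD] at h ⊢
    simpa only [hβq] using h
  obtain ⟨L, hL⟩ := exists_sum_mul_eq o.toBasis S
    (fun X Y => by
      rw [hS, hS, hD, hD, real_inner_comm]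
      simp only [real_inner_comm])
    (fun X => by
      rw [hS, real_inner_self_eq_norm_sq, sub_nonneg, one_div, inv_mul_le_iff₀ (by positivity)]
      have h1 : K ≤ 3 * s ^ 2 := by simp only [s]; nlinarith
      have h2 := mul_le_mul_of_nonneg_right h1 (sq_nonneg ‖q X‖)
      have := hDq X
      linarith)
  -- S vanishes on brackets, which are central and killed by q; a vanishing sum of squares has
  -- vanishing terms.
  have hLβ (X Y : V) : L (β X Y) = 0 := by
    have h := hL (β X Y) (β X Y)
    rw [hS, hqβ, hD] at h
    simp only [hnil, inner_zero_left, Finset.sum_const_zero, mul_zero, sub_zero] at h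
    ext k
    have := (Finset.sum_eq_zero_iff_of_nonneg fun i _ => mul_self_nonneg _).1 h k (Finset.mem_univ k)
    simpa using this
  have hin (X Y : V) : ∑ k, ⟪o k, X⟫_ℝ * ⟪o k, Y⟫_ℝ = ⟪X, Y⟫_ℝ := by
    rw [← o.sum_inner_mul_inner]
    exact Finset.sum_congr rfl fun k _ => by rw [real_inner_comm]
  have hexp (X Y : V) (i : Fin d) :
      ∑ k, ⟪o i, β X (o k)⟫_ℝ * ⟪o k, Y⟫_ℝ = ⟪o i, β X Y⟫_ℝ := by
    conv_rhs => rw [← o.sum_repr' Y]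
    simp only [map_sum, map_smul, inner_sum, inner_smul_right]
    exact Finset.sum_congr rfl fun k _ => mul_comm _ _
  let a : V →ₗ[ℝ] Fin d ⊕ Fin d → ℝ :=
    { toFun := fun X => Sum.elim (fun k => s * ⟪o k, q X⟫_ℝ) (fun k => 2 * s * L X k)
      map_add' := fun X Y => by
        ext (k | k) <;> simp [mul_add, inner_add_right]
      map_smul' := fun c X => by
        ext (k | k) <;> simp [inner_smul_right] <;> ring }
  let B : V →ₗ[ℝ] Fin d → Fin d ⊕ Fin d → ℝ :=
    { toFun := fun X i => Sum.elim (fun k => ⟪o i, β X (o k)⟫_ℝ) (fun _ => 0)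
      map_add' := fun X Y => by
        ext i (k | k) <;> simp [inner_add_right]
      map_smul' := fun c X => by
        ext i (k | k) <;> simp [inner_smul_right] }
  let z : V →ₗ[ℝ] Fin d → ℝ :=
    -- The factor 2 against s in `a` produces the ½: B X applied to a Y is s[X, Y] = ½ · 2s[X, Y].
    { toFun := fun X i => 2 * s * ⟪o i, p X⟫_ℝ
      map_add' := fun X Y => by ext i; simp [mul_add, inner_add_right]
      map_smul' := fun c X => by ext i; simp [inner_smul_right]; ring }
  have ha1 (X : V) (k : Fin d) : a X (.inl k) = s * ⟪o k, q X⟫_ℝ := rfl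
  have ha2 (X : V) (k : Fin d) : a X (.inr k) = 2 * s * L X k := rfl
  have hB1 (X : V) (i k : Fin d) : B X i (.inl k) = ⟪o i, β X (o k)⟫_ℝ := rfl
  have hB2 (X : V) (i k : Fin d) : B X i (.inr k) = 0 := rfl
  have hz (X : V) (i : Fin d) : z X i = 2 * s * ⟪o i, p X⟫_ℝ := rfl
  obtain ⟨n, r, hr0, hrm, hr⟩ := exists_representation_of_maps (fun X Y => β X Y) a z B
    (fun X Y => by
      ext (k | k)
      · change a (β X Y) _ = 0
        rw [ha1, hqβ, inner_zero_right, mul_zero]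
      · change a (β X Y) _ = 0
        rw [ha2, hLβ, Pi.zero_apply, mul_zero])
    (fun X Y => by
      ext i (k | k)
      · change B (β X Y) i _ = 0
        rw [hB1, hnil, inner_zero_right]
      · exact hB2 _ _ _)
    (fun X Y i => by
      have h := hexp X (q Y) i
      rw [hβq'] at h
      simp only [Fintype.sum_sum_type, ha1, hB1, hB2, zero_mul, Finset.sum_const_zero, add_zero, hz,
        hpβ, ← h, Finset.mul_sum]
      refine Finset.sum_congr rfl fun k _ => ?_
      ring)
  refine ⟨n, 1 / (4 * s ^ 2), r, by positivity, hr0, hrm, fun X Y => ?_⟩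
  have e1 : ∑ k, a X k * a Y k = s ^ 2 * ⟪q X, q Y⟫_ℝ + 4 * s ^ 2 * S X Y := by
    rw [Fintype.sum_sum_type, ← hL, ← hin, Finset.mul_sum, Finset.mul_sum]
    congr 1
    · exact Finset.sum_congr rfl fun k _ => by rw [ha1, ha1]; ring
    · exact Finset.sum_congr rfl fun k _ => by rw [ha2, ha2]; ring
  have e2 : ∑ i, z X i * z Y i = 4 * s ^ 2 * ⟪p X, p Y⟫_ℝ := by
    rw [← hin, Finset.mul_sum]
    exact Finset.sum_congr rfl fun k _ => by rw [hz, hz]; ring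
  have e3 : ∑ i, ∑ k, B X i k * B Y i k = D X Y := by
    simp only [Fintype.sum_sum_type, hB1, hB2, zero_mul, Finset.sum_const_zero, add_zero]
    rw [hD, Finset.sum_comm]
    exact Finset.sum_congr rfl fun k _ => hin _ _
  rw [hr, e1, e2, e3, hS, ← hpq X Y]
  field_simp
  ring

end EuclideanRepresentation

/-! ### From an arbitrary inner product to Euclidean space -/

section Transfer

/-- A two-step nilpotent Lie algebra with an inner product `γ` has a strictly lower triangular
representation which is isometric for a multiple of the Einstein inner product. -/
theorem exists_isometric_representation {V : Type*} [AddCommGroup V] [Module ℝ V]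
    [FiniteDimensional ℝ V] (β : V →ₗ[ℝ] V →ₗ[ℝ] V)
    (halt : ∀ X, β X X = 0) (hnil : ∀ X Y Z, β (β X Y) Z = 0) (γ : V →ₗ[ℝ] V →ₗ[ℝ] ℝ)
    (hsymm : ∀ X Y, γ X Y = γ Y X) (hpos : ∀ X, X ≠ 0 → 0 < γ X X) :
    ∃ (n : ℕ) (c : ℝ) (r : V →ₗ[ℝ] lowerTriangular n), 0 < c ∧
      (∀ X i, (r X).1 i i = 0) ∧ (∀ X Y, r X * r Y = (1 / 2 : ℝ) • r (β X Y)) ∧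
      ∀ X Y, c * einsteinForm n (r X) (r Y) = γ X Y := by
  obtain ⟨L, hL⟩ := exists_sum_mul_eq (Module.finBasis ℝ V) γ hsymm (fun X => by
    rcases eq_or_ne X 0 with rfl | h
    · simp
    · exact (hpos X h).le)
  -- Writing γ as a sum of squares makes L an isometry from (V, γ) to Euclidean space, injective by
  -- definiteness; the bracket is carried along it.
  let T₀ : V →ₗ[ℝ] EuclideanSpace ℝ (Fin (Module.finrank ℝ V)) :=
    (WithLp.linearEquiv 2 ℝ (Fin (Module.finrank ℝ V) → ℝ)).symm.toLinearMap ∘ₗ L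
  have hinj : Function.Injective T₀ := by
    rw [injective_iff_map_eq_zero]
    intro X hX
    by_contra h
    have hLX : L X = 0 := congrArg WithLp.ofLp hX
    have := hL X X
    simp only [hLX, Pi.zero_apply, mul_zero, Finset.sum_const_zero] at this
    exact (hpos X h).ne this
  let T := LinearEquiv.ofInjectiveOfFinrankEq T₀ hinj (by simp)
  have hT (X Y : V) : inner ℝ (T X) (T Y) = γ X Y := by
    rw [← hL]
    simp [PiLp.inner_apply, mul_comm]
    rfl
  obtain ⟨n, c, r, hc, hr0, hrm, hr⟩ := exists_representation_of_orthonormalBasis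
    (EuclideanSpace.basisFun (Fin (Module.finrank ℝ V)) ℝ)
    ((β.compl₁₂ T.symm.toLinearMap T.symm.toLinearMap).compr₂ T.toLinearMap)
    (fun X => by simp [halt]) (fun X Y Z => by simp [hnil])
  refine ⟨n, c, r ∘ₗ T.toLinearMap, hc, fun X i => hr0 _ i, fun X Y => ?_, fun X Y => ?_⟩
  · simpa using hrm (T X) (T Y)
  · exact (hr (T X) (T Y)).trans (hT X Y)

end Transfer

/-! ### The homomorphism X ↦ 1 + r X and the conclusion -/

section Unipotent

variable {n : ℕ} {V : Type*} [AddCommGroup V] [Module ℝ V] (r : V →ₗ[ℝ] lowerTriangular n)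
  (hr : ∀ X i, (r X).1 i i = 0)

/-- The matrix `1 + r X`, for a strictly lower triangular representation `r`. -/
def unipotent (X : V) : TriangularGroup n :=
  ⟨1 + r X, fun i => by
    have h : (1 + r X).1 i i = (1 : Matrix (Fin n) (Fin n) ℝ) i i + (r X).1 i i := rfl
    rw [h, hr, Matrix.one_apply_eq, add_zero]
    exact one_pos⟩

theorem coe_unipotent (X : V) : (unipotent r hr X).1 = 1 + r X := rfl

end Unipotent

theorem einsteinMetric_inner_mul {n : ℕ} {c : ℝ} (hc : 0 < c) (A : TriangularGroup n)
    (U V : lowerTriangular n) :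
    (einsteinMetric n c hc).inner A (A.1 * U : lowerTriangular n) (A.1 * V : lowerTriangular n) =
      c * einsteinForm n U V := by
  have h : (A⁻¹).1 * A.1 = 1 := congrArg Subtype.val (inv_mul_cancel A)
  change translatedForm n c (A⁻¹).1 (A.1 * U) (A.1 * V) = _
  rw [translatedForm_apply, ← mul_assoc, ← mul_assoc, h, one_mul, one_mul]

section IsometricEmbedding

variable {E : Type*} [NormedAddCommGroup E] [NormedSpace ℝ E] {n : ℕ}
  (r : E →ₗ[ℝ] lowerTriangular n) (hr : ∀ X i, (r X).1 i i = 0)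

/-- The quadratic term of (1 + r X)(1 + r Y) is r X · r Y = ½ r [X, Y], the BCH correction. -/
theorem unipotent_bchMul (β : E →L[ℝ] E →L[ℝ] E)
    (hrm : ∀ X Y, r X * r Y = (1 / 2 : ℝ) • r (β X Y)) (X Y : E) :
    unipotent r hr (bchMul β X Y) = unipotent r hr X * unipotent r hr Y := by
  apply Subtype.ext
  rw [TriangularGroup.coe_mul, coe_unipotent, coe_unipotent, coe_unipotent, bchMul, map_add,
    map_add, map_smul, ← hrm, mul_add, add_mul, add_mul, mul_one, mul_one, one_mul]
  abel

theorem IsLeftInvariantMetric.inner_leftDeriv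
    {G : Type*} [TopologicalSpace G] [ChartedSpace E G] [Group G] [LieGroup 𝓘(ℝ, E) ∞ G]
    {g : Bundle.ContMDiffRiemannianMetric 𝓘(ℝ, E) ∞ E (fun x : G => TangentSpace 𝓘(ℝ, E) x)}
    (hg : IsLeftInvariantMetric g) (x : G) (v w : E) :
    g.inner x (leftDeriv x 1 v : E) (leftDeriv x 1 w : E) = g.inner 1 v w := by
  have key (z : G) (hz : z = x) (a b : E) : g.inner z a b = g.inner x a b := by
    subst hz; rfl
  exact (key (x * 1) (mul_one x) _ _).symm.trans (hg x 1 v w)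

variable [FiniteDimensional ℝ E]

theorem contMDiff_unipotent :
    ContMDiff 𝓘(ℝ, E) 𝓘(ℝ, lowerTriangular n) ∞ (unipotent r hr) := by
  rw [← ContMDiff.subtypeVal_comp_iff]
  exact (contDiff_const.add (LinearMap.toContinuousLinearMap r).contDiff).contMDiff

theorem isEmbedding_unipotent (hinj : Function.Injective r) :
    Topology.IsEmbedding (unipotent r hr) := by
  refine Topology.IsEmbedding.of_comp (contMDiff_unipotent r hr).continuous continuous_subtype_val ?_
  exact (Homeomorph.addLeft (1 : lowerTriangular n)).isEmbedding.comp
    (LinearMap.isClosedEmbedding_of_injective (LinearMap.ker_eq_bot.2 hinj)).isEmbedding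

theorem hasMFDerivAt_unipotent (X : E) :
    HasMFDerivAt 𝓘(ℝ, E) 𝓘(ℝ, lowerTriangular n) (unipotent r hr) X
      (LinearMap.toContinuousLinearMap r : E →L[ℝ] lowerTriangular n) := by
  have h : HasFDerivAt (fun X => 1 + r X) (LinearMap.toContinuousLinearMap r) X :=
    (LinearMap.toContinuousLinearMap r).hasFDerivAt.const_add 1
  exact ⟨(contMDiff_unipotent r hr).continuous.continuousAt, h.hasMFDerivAt.2⟩

end IsometricEmbedding

open Bundle in
theorem mainTheorem5
    {E : Type*} [NormedAddCommGroup E] [NormedSpace ℝ E] [FiniteDimensional ℝ E]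
    {G : Type*} [TopologicalSpace G] [ChartedSpace E G] [Group G] [LieGroup 𝓘(ℝ, E) ∞ G]
    [SimplyConnectedSpace G] (hG : IsTwoStepNilpotentLieGroup E G)
    (g : ContMDiffRiemannianMetric 𝓘(ℝ, E) ∞ E (fun x : G => TangentSpace 𝓘(ℝ, E) x))
    (hg : IsLeftInvariantMetric g) :
    ∃ (n : ℕ) (c : ℝ) (hc : 0 < c) (φ : G →* TriangularGroup n),
      IsIsometricEmbedding g (einsteinMetric n c hc) φ := by
  obtain ⟨Ψ, hΨ, hΨ1, hmul, hlog⟩ := exists_global_logarithm hG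
  let γ : E →L[ℝ] E →L[ℝ] ℝ := g.inner 1
  have hγpos : ∀ X : E, X ≠ 0 → 0 < γ X X := fun X hX => g.pos 1 X hX
  obtain ⟨n, c, r, hc, hr0, hrm, hr⟩ := exists_isometric_representation
    (LinearMap.mk₂ ℝ (fun X Y => groupBracket E G X Y) (by simp) (by simp) (by simp) (by simp))
    (groupBracket_self E G) (groupBracket_groupBracket hG)
    (LinearMap.mk₂ ℝ (fun X Y => γ X Y) (by simp) (by simp) (by simp) (by simp))
    (fun X Y => g.symm 1 X Y) hγpos
  have hinj : Function.Injective r := by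
    rw [injective_iff_map_eq_zero]
    intro X hX
    by_contra h
    have h1 := hr X X
    rw [hX, map_zero, mul_zero] at h1
    exact (hγpos X h).ne h1
  refine ⟨n, c, hc, MonoidHom.mk' (fun x => unipotent r hr0 (Ψ x)) fun x y => ?_,
    (contMDiff_unipotent r hr0).comp hΨ,
    (isEmbedding_unipotent r hr0 hinj).comp
      (isEmbedding_of_isLogarithmicAt hG hΨ hΨ1 hmul (hlog 1)),
    fun x v w => ?_⟩
  · rw [hmul]
    exact unipotent_bchMul r hr0 _ hrm _ _
  · obtain ⟨F', hF, hF'⟩ := hlog x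
    have hd := ((hasMFDerivAt_unipotent r hr0 (Ψ x)).comp x hF).mfderiv
    -- The product identity for r turns the logarithmic derivative v + ½[Ψ x, v] into left
    -- translation of r v by φ x.
    have hrF (v : E) : r (F' (leftDeriv x 1 v)) = (unipotent r hr0 (Ψ x)).1 * r v := by
      rw [hF', coe_unipotent, add_mul, one_mul, hrm, map_add, map_smul]
      rfl
    obtain ⟨v, rfl⟩ := (isInvertible_leftDeriv (E := E) x 1).surjective v
    obtain ⟨w, rfl⟩ := (isInvertible_leftDeriv (E := E) x 1).surjective w
    refine Eq.trans ?_ (hg.inner_leftDeriv x v w).symm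
    refine Eq.trans ?_ (hr v w)
    rw [← einsteinMetric_inner_mul hc (unipotent r hr0 (Ψ x)), ← hrF, ← hrF]
    have hdv (v : E) : mfderiv 𝓘(ℝ, E) 𝓘(ℝ, lowerTriangular n)
        (fun x => unipotent r hr0 (Ψ x)) x v = r (F' v) := DFunLike.congr_fun hd v
    exact congrArg₂ (fun a b : lowerTriangular n =>
      (einsteinMetric n c hc).inner (unipotent r hr0 (Ψ x)) a b) (hdv _) (hdv _)
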